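/- Theorem 1 (Light tail case). Let $N>1$, $E=\{1,\dots,N\}$, and let $X=(X_t)_{t\ge 0}$ be a Markov jump process on $E$, defined on a probability space $(\Omega,\mathcal A,Q)$, with positive intensity function $\lambda$ and irreducible stochastic jump kernel $q$ with $q(i,i)=0$ for all $i$, started from its invariant probability measure $\mu$. Let $W$ be a standard Brownian motion with respect to a filtration $(\mathcal F_t)_{t\ge0}$ on a probability space $(\Theta,\mathcal B,Q')$, let $a,\sigma:E\to\mathbb R$, and let $Y$, defined on $(\Omega\times\Theta, Q\otimes Q')$, be a solution of $$dY_t=a(X_t)Y_t\,dt+\sigma(X_t)\,dW_t,\qquad t\ge 0,$$ where $Y_0$ is an $\mathcal F_0$-measurable random variable on $\Theta$. Assume $\sum_{i\in E}a(i)\mu(i)<0$ and $a(i)\le 0$ for every $i\in E$. Then there is exactly one probability measure $\nu$ on $\mathbb R$ (the stationary distribution of $Y$) such that, whatever the initial condition $Y_0$, the law of $Y_t$ converges weakly to $\nu$ as $t\to\infty$; and $\nu$ has finite moments of all orders: $\int_{\mathbb R}|x|^s\,\nu(dx)<\infty$ for every $s>0$. -/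

import Mathlib

open MeasureTheory ProbabilityTheory Filter Topology
open scoped NNReal ENNReal Matrix

noncomputable section

namespace MarkovSwitching

/-- The infinitesimal generator `λ(i) (q(i,j) - 1_{i=j})` of the Markov jump process with intensity
function `lam` and jump kernel `q`. -/
def generator {N : ℕ} (lam : Fin N → ℝ) (q : Matrix (Fin N) (Fin N) ℝ) :
    Matrix (Fin N) (Fin N) ℝ :=
  Matrix.diagonal lam * (q - 1)

/-- The transition matrix at time `t`, i.e. `exp (t G)` with `G` the generator. -/
def transition {N : ℕ} (lam : Fin N → ℝ) (q : Matrix (Fin N) (Fin N) ℝ) (t : ℝ≥0) :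
    Matrix (Fin N) (Fin N) ℝ :=
  NormedSpace.exp ((t : ℝ) • generator lam q)

/-- `mu` is an invariant probability vector of the Markov jump process. -/
structure IsInvariantProbability {N : ℕ} (lam : Fin N → ℝ) (q : Matrix (Fin N) (Fin N) ℝ)
    (mu : Fin N → ℝ) : Prop where
  mem_stdSimplex : mu ∈ stdSimplex ℝ (Fin N)
  invariant : ∀ t : ℝ≥0, mu ᵥ* transition lam q t = mu

/-- `0 = τ 0 ≤ τ 1 ≤ ... ≤ τ n = t` is a subdivision of `[0, t]` such that the path `x` is constant
on each of the intervals `[τ k, τ (k + 1))`. -/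
structure IsSubdivision {E : Type*} (x : ℝ≥0 → E) (t : ℝ≥0) (n : ℕ) (τ : ℕ → ℝ≥0) : Prop where
  zero : τ 0 = 0
  last : τ n = t
  mono : Monotone τ
  const : ∀ k < n, ∀ u, τ k ≤ u → u < τ (k + 1) → x u = x (τ k)

/-- `X` is a Markov jump process on `{1, ..., N}` with intensity `lam`, jump kernel `q` and initial
law `mu`: its paths are right-continuous step functions with finitely many jumps on every bounded
time interval, and its finite-dimensional laws are those given by `mu` and the transition
semigroup. -/
structure IsMarkovJumpProcess {N : ℕ} (lam : Fin N → ℝ) (q : Matrix (Fin N) (Fin N) ℝ)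
    (mu : Fin N → ℝ) {Ω : Type*} [MeasurableSpace Ω] (Q : Measure Ω)
    (X : ℝ≥0 → Ω → Fin N) : Prop where
  measurable : ∀ t, Measurable (X t)
  step_path : ∀ᵐ ω ∂Q, ∀ t, ∃ n τ, IsSubdivision (fun u => X u ω) t n τ
  law : ∀ (n : ℕ) (t : ℕ → ℝ≥0) (i : ℕ → Fin N), t 0 = 0 → Monotone t →
    Q.real {ω | ∀ k ≤ n, X (t k) ω = i k} =
      mu (i 0) * ∏ k ∈ Finset.range n, transition lam q (t (k + 1) - t k) (i k) (i (k + 1))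

/-- `W` is a standard real Brownian motion relative to the filtration `F`. -/
structure IsFiltrationBrownian {Θ : Type*} {mΘ : MeasurableSpace Θ} (Q' : Measure Θ)
    (F : Filtration ℝ≥0 mΘ) (W : ℝ≥0 → Θ → ℝ) : Prop where
  brownian : IsBrownianReal W Q'
  adapted : Adapted F W
  indep : ∀ s t : ℝ≥0, s ≤ t →
    Indep (MeasurableSpace.comap (fun θ => W t θ - W s θ) inferInstance) (F s) Q'

/-- `Y`, defined on the product space, is a solution of `dY_t = a(X_t) Y_t dt + σ(X_t) dW_t`
whose initial value is an `F 0`-measurable random variable on `Θ`.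

For a fixed `ω` the integrand `u ↦ σ(X_u(ω))` is a deterministic step function, and its stochastic
integral over `[0, t]` is the elementary one: the sum of `σ(X_{τ k}) (W_{τ (k+1)} - W_{τ k})` along
a subdivision between whose points `X` is constant (the sum is the same for all of them). -/
structure IsSwitchingDiffusion {N : ℕ} (a σ : Fin N → ℝ)
    {Ω : Type*} [MeasurableSpace Ω] (Q : Measure Ω) (X : ℝ≥0 → Ω → Fin N)
    {Θ : Type*} {mΘ : MeasurableSpace Θ} (Q' : Measure Θ) (F : Filtration ℝ≥0 mΘ)
    (W : ℝ≥0 → Θ → ℝ) (Y : ℝ≥0 → Ω × Θ → ℝ) : Prop where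
  aemeasurable : ∀ t, AEMeasurable (Y t) (Q.prod Q')
  initial : ∃ η : Θ → ℝ, Measurable[F 0] η ∧ ∀ᵐ p ∂(Q.prod Q'), Y 0 p = η p.2
  continuous : ∀ᵐ p ∂(Q.prod Q'), Continuous fun t => Y t p
  sde : ∀ᵐ p ∂(Q.prod Q'), ∀ (t : ℝ≥0) (n : ℕ) (τ : ℕ → ℝ≥0),
    IsSubdivision (fun u => X u p.1) t n τ →
      Y t p = Y 0 p + (∫ u in (0 : ℝ)..t, a (X u.toNNReal p.1) * Y u.toNNReal p)
        + ∑ k ∈ Finset.range n, σ (X (τ k) p.1) * (W (τ (k + 1)) p.2 - W (τ k) p.2)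

/-- `ν` is the limit law of the switching diffusion: whatever the initial condition, the law of
`Y_t` converges weakly to `ν` as `t → ∞`. -/
def IsLimitLaw {N : ℕ} (a σ : Fin N → ℝ)
    {Ω : Type*} [MeasurableSpace Ω] (Q : Measure Ω) [IsProbabilityMeasure Q]
    (X : ℝ≥0 → Ω → Fin N)
    {Θ : Type*} {mΘ : MeasurableSpace Θ} (Q' : Measure Θ) [IsProbabilityMeasure Q']
    (F : Filtration ℝ≥0 mΘ) (W : ℝ≥0 → Θ → ℝ) (ν : ProbabilityMeasure ℝ) : Prop :=
  ∀ Y : ℝ≥0 → Ω × Θ → ℝ, IsSwitchingDiffusion a σ Q X Q' F W Y →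
    TendstoInDistribution Y atTop (id : ℝ → ℝ) (fun _ => Q.prod Q') (ν : Measure ℝ)

end MarkovSwitching

end

noncomputable section

namespace MarkovSwitching

/-! ### Subdivisions and right-continuous step paths -/

section Subdivision

variable {E : Type*} {x : ℝ≥0 → E} {t : ℝ≥0} {n : ℕ} {τ : ℕ → ℝ≥0}

/-! Freeze the path of `X`. The equation becomes linear with step coefficients, and variation of
constants writes `Y t` as `decay` times `Y 0` plus a term D_t (`centered`). This term is a Wiener
integral of a deterministic function, hence centered Gaussian with variance V_t = `condVar`
(`hasLaw_sub_decay_mul`). The characteristic function of D_t at ξ is thus E exp(-ξ² V_t / 2), the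
same for every solution (`charFun_centered`).

Convergence comes from stationarity. Discarding [0, s] from the integral defining V_{s+t} leaves the
variance at time t along the path shifted by s, which has the law of V_t. The Laplace transform of
V_t is therefore nonincreasing in t and has a limit (`antitone_integral_exp_condVar`).

The quantitative input is the geometric decay of E exp(κ ∫ a(X_u) du) over n units of time
(`exists_integral_decay_pow_le`). Jensen's inequality reduces it to samples at unit spacing.
Irreducibility makes the time-one transition matrix positive, and a ≤ 0 is negative at some state,
so each further sample costs a factor ρ < 1. Minkowski's inequality then bounds every moment of V_n
uniformly in n. The first moment makes the limiting characteristic function continuous at 0, which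
yields tightness and the limit law. The others pass to that law, since even Gaussian moments are
multiples of powers of the variance. Finally `decay` tends to 0 almost surely, which erases the
initial condition (Slutsky). -/

lemma IsSubdivision.truncate (h : IsSubdivision x t n τ) {k : ℕ} (hk : k ≤ n) :
    IsSubdivision x (τ k) k τ :=
  ⟨h.zero, rfl, h.mono, fun j hj => h.const j (hj.trans_le hk)⟩

/-- Inserting the midpoint of each interval of a subdivision. -/
lemma IsSubdivision.halve (h : IsSubdivision x t n τ) :
    IsSubdivision x t (2 * n) (fun j => (τ (j / 2) + τ ((j + 1) / 2)) / 2) where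
  zero := by simp [h.zero]
  last := by
    have h1 : 2 * n / 2 = n := by omega
    have h2 : (2 * n + 1) / 2 = n := by omega
    simp [h1, h2, h.last]
  mono i j hij := by
    have h1 := h.mono (show i / 2 ≤ j / 2 by omega)
    have h2 := h.mono (show (i + 1) / 2 ≤ (j + 1) / 2 by omega)
    exact div_le_div_of_nonneg_right (add_le_add h1 h2) (by simp)
  const k hk u hu hu' := by
    have hk' : k / 2 < n := by omega
    have e : (k + 1 + 1) / 2 = k / 2 + 1 := by omega
    rw [e] at hu'
    have m1 : τ (k / 2) ≤ τ ((k + 1) / 2) := h.mono (by omega)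
    have m2 : τ ((k + 1) / 2) ≤ τ (k / 2 + 1) := h.mono (by omega)
    have l1 : τ (k / 2) ≤ (τ (k / 2) + τ ((k + 1) / 2)) / 2 := by
      rw [le_div_iff₀ (by simp), mul_two]; gcongr
    have l2 : (τ ((k + 1) / 2) + τ (k / 2 + 1)) / 2 ≤ τ (k / 2 + 1) := by
      rw [div_le_iff₀ (by simp), mul_two]; gcongr
    rw [h.const _ hk' u (l1.trans hu) (hu'.trans_le l2),
      h.const _ hk' _ l1 ((hu.trans_lt hu').trans_le l2)]

/-- Repeated halving: one subdivision yields arbitrarily fine ones, and the equation is available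
along each of them. -/
lemma IsSubdivision.exists_mesh_le (h : IsSubdivision x t n τ) (m : ℕ) :
    ∃ n' τ', IsSubdivision x t n' τ' ∧
      ∀ k < n', ((τ' (k + 1) : ℝ) - τ' k) ≤ t / 2 ^ m := by
  induction m with
  | zero =>
    refine ⟨n, τ, h, fun k hk => ?_⟩
    have h1 : τ (k + 1) ≤ t := h.last ▸ h.mono hk
    have h2 : (τ (k + 1) : ℝ) ≤ t := by exact_mod_cast h1
    have := (τ k).coe_nonneg
    simp only [pow_zero, div_one]
    linarith
  | succ m ih =>
    obtain ⟨n', τ', h', hm⟩ := ih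
    refine ⟨_, _, h'.halve, fun k hk => ?_⟩
    have := hm (k / 2) (by omega)
    have e : (k + 1 + 1) / 2 = k / 2 + 1 := by omega
    rw [e]
    push_cast
    rw [pow_succ, ← div_div]
    linarith

/-- The path is locally constant to the right of each time. -/
def RightConst (x : ℝ≥0 → E) : Prop := ∀ t, ∀ᶠ u in 𝓝[>] t, x u = x t

lemma RightConst.of_subdivision (h : ∀ t, ∃ n τ, IsSubdivision x t n τ) : RightConst x := by
  intro t
  -- The horizon `t + 1` puts `t` strictly inside the subdivided interval, so some subdivision point
  -- lies beyond it.
  obtain ⟨n, τ, hτ⟩ := h (t + 1)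
  have hex : ∃ j, t < τ j := ⟨n, by rw [hτ.last]; simp⟩
  classical
  set j := Nat.find hex with hj
  have hj1 : t < τ j := Nat.find_spec hex
  have hj0 : j ≠ 0 := by
    intro h0
    rw [h0, hτ.zero] at hj1
    simp at hj1
  obtain ⟨k, hk⟩ := Nat.exists_eq_succ_of_ne_zero hj0
  have hkt : τ k ≤ t := not_lt.1 (Nat.find_min hex (by omega))
  have hjn : j ≤ n := Nat.find_min' hex (by rw [hτ.last]; simp)
  rw [hk] at hj1
  have hkn : k < n := by omega
  filter_upwards [Ioo_mem_nhdsGT hj1] with u hu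
  rw [hτ.const k hkn u (hkt.trans hu.1.le) hu.2, hτ.const k hkn t hkt hj1]

lemma RightConst.shift (h : RightConst x) (s : ℝ≥0) : RightConst (fun u => x (s + u)) := by
  intro t
  refine (tendsto_nhdsWithin_iff.2 ⟨?_, ?_⟩ : Tendsto (fun u => s + u) (𝓝[>] t)
    (𝓝[>] (s + t))).eventually (h (s + t))
  · exact ((continuous_const_add s).tendsto t).mono_left nhdsWithin_le_nhds
  · filter_upwards [self_mem_nhdsWithin] with u hu
    exact add_lt_add_right hu s

lemma RightConst.toNNReal (h : RightConst x) (u : ℝ) :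
    ∀ᶠ v in 𝓝[>] u, x v.toNNReal = x u.toNNReal := by
  rcases lt_or_ge u 0 with hu | hu
  · filter_upwards [Ioo_mem_nhdsGT hu] with v hv
    rw [Real.toNNReal_of_nonpos hv.2.le, Real.toNNReal_of_nonpos hu.le]
  · refine (tendsto_nhdsWithin_iff.2 ⟨?_, ?_⟩ : Tendsto Real.toNNReal (𝓝[>] u)
      (𝓝[>] u.toNNReal)).eventually (h u.toNNReal)
    · exact (continuous_real_toNNReal.tendsto u).mono_left nhdsWithin_le_nhds
    · filter_upwards [self_mem_nhdsWithin] with v hv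
      exact (Real.toNNReal_lt_toNNReal_iff (hu.trans_lt hv)).2 hv

/-- The points `(k + 1) / (n + 1)` of the grid of step `1 / (n + 1)`. -/
def gridPoint (n k : ℕ) : ℝ≥0 := (k + 1) / (n + 1)

/-- The index of the first grid point larger than `u`. -/
def gridIndex (n : ℕ) (u : ℝ≥0) : ℕ := ⌊((n : ℝ≥0) + 1) * u⌋₊

lemma measurable_gridIndex (n : ℕ) : Measurable (gridIndex n) := by
  unfold gridIndex
  fun_prop

/-- The smallest multiple of `1 / (n + 1)` which is larger than `u`. -/
def gridAbove (n : ℕ) (u : ℝ≥0) : ℝ≥0 := gridPoint n (gridIndex n u)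

/-- The sampling point lies strictly to the right of `u`, even when `u` is on the grid; a
right-constant path sampled there is eventually equal to its value at `u`. -/
lemma tendsto_gridAbove (u : ℝ≥0) : Tendsto (fun n => gridAbove n u) atTop (𝓝[>] u) := by
  refine tendsto_nhdsWithin_iff.2 ⟨?_, Eventually.of_forall fun n => ?_⟩
  · have hle : ∀ n : ℕ, gridAbove n u ≤ u + 1 / (n + 1) := fun n => by
      unfold gridAbove gridPoint gridIndex
      rw [add_div]
      gcongr
      rw [div_le_iff₀ (by positivity), mul_comm u]
      exact Nat.floor_le (by positivity)
    have hge : ∀ n : ℕ, u ≤ gridAbove n u := fun n => by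
      unfold gridAbove gridPoint gridIndex
      rw [le_div_iff₀ (by positivity), mul_comm]
      exact (Nat.lt_floor_add_one _).le
    have hlim : Tendsto (fun n : ℕ => u + 1 / ((n : ℝ≥0) + 1)) atTop (𝓝 (u + 0)) :=
      tendsto_const_nhds.add tendsto_one_div_add_atTop_nhds_zero_nat
    rw [add_zero] at hlim
    exact tendsto_of_tendsto_of_tendsto_of_le_of_le tendsto_const_nhds hlim hge hle
  · change u < gridAbove n u
    unfold gridAbove gridPoint gridIndex
    rw [lt_div_iff₀ (by positivity), mul_comm]
    exact Nat.lt_floor_add_one _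

lemma RightConst.eventually_gridAbove (h : RightConst x) (u : ℝ≥0) :
    ∀ᶠ n in atTop, x (gridAbove n u) = x u :=
  (tendsto_gridAbove u).eventually (h u)

/-- Joint measurability of a process sampled at a countably-valued time. -/
lemma measurable_comp_countable_time {Ω : Type*} [MeasurableSpace Ω] {X : ℝ≥0 → Ω → E}
    [MeasurableSpace E] (hX : ∀ t, Measurable (X t)) {T : ℝ≥0 → ℝ≥0} {G : ℕ → ℝ≥0} {f : ℝ≥0 → ℕ}
    (hf : Measurable f) (hT : ∀ u, T u = G (f u)) :
    Measurable fun p : ℝ≥0 × Ω => X (T p.1) p.2 := by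
  have h1 : Measurable fun p : ℕ × Ω => X (G p.1) p.2 :=
    measurable_from_prod_countable_right fun k => hX (G k)
  simp only [hT]
  exact h1.comp (hf.prodMap measurable_id)

/-- Joint measurability of a right-continuous step process. -/
lemma measurable_uncurry_of_rightConst {Ω : Type*} [MeasurableSpace Ω] {X : ℝ≥0 → Ω → E}
    [MeasurableSpace E] [DiscreteMeasurableSpace E] (hX : ∀ t, Measurable (X t))
    (hc : ∀ ω, RightConst fun t => X t ω) (f : E → ℝ) :
    Measurable fun p : ℝ≥0 × Ω => f (X p.1 p.2) := by
  refine measurable_of_tendsto_metrizable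
    (fun n => (Measurable.of_discrete (f := f)).comp (measurable_comp_countable_time hX (T := gridAbove n)
      (G := gridPoint n) (measurable_gridIndex n) fun _ => rfl)) ?_
  refine tendsto_pi_nhds.2 fun p => tendsto_const_nhds.congr' ?_
  filter_upwards [(hc p.2).eventually_gridAbove p.1] with n hn
  simp [hn]

lemma RightConst.measurable_comp [MeasurableSpace E] [DiscreteMeasurableSpace E]
    (h : RightConst x) (f : E → ℝ) : Measurable fun u => f (x u) := by
  have := measurable_uncurry_of_rightConst (Ω := Unit) (X := fun t _ => x t)
    (fun t => measurable_const) (fun _ => h) f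
  exact this.comp (measurable_id.prodMk (measurable_const (a := ())))

end Subdivision

/-! ### Pathwise functionals -/

section Path

variable {N : ℕ} {a σ : Fin N → ℝ} {x : ℝ≥0 → Fin N}

/-- The propagator `exp (∫ a(x_u) du)` over `[s, t]` of the linear equation `y' = a(x) y`. -/
def decay (a : Fin N → ℝ) (x : ℝ≥0 → Fin N) (s t : ℝ) : ℝ :=
  Real.exp (∫ u in s..t, a (x u.toNNReal))

/-- The variance at time `t`, for a frozen path `x`, of the solution started at `0`. -/
def condVar (a σ : Fin N → ℝ) (x : ℝ≥0 → Fin N) (t : ℝ) : ℝ :=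
  ∫ u in (0 : ℝ)..t, decay a x u t ^ 2 * σ (x u.toNNReal) ^ 2

lemma _root_.Measurable.intervalIntegrable_of_bound {f : ℝ → ℝ} (hf : Measurable f) {C : ℝ}
    (hC : ∀ u, |f u| ≤ C) (s t : ℝ) : IntervalIntegrable f volume s t :=
  (intervalIntegrable_const (c := C)).mono_fun hf.aestronglyMeasurable
    (Eventually.of_forall fun u => by
      simpa [Real.norm_eq_abs] using (hC u).trans (le_abs_self C))

lemma measurable_path (hx : ∀ f : Fin N → ℝ, Measurable fun u => f (x u)) (f : Fin N → ℝ) :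
    Measurable fun u : ℝ => f (x u.toNNReal) :=
  (hx f).comp measurable_real_toNNReal

lemma intervalIntegrable_path (hx : ∀ f : Fin N → ℝ, Measurable fun u => f (x u))
    (f : Fin N → ℝ) (s t : ℝ) :
    IntervalIntegrable (fun u : ℝ => f (x u.toNNReal)) volume s t :=
  (measurable_path hx f).intervalIntegrable_of_bound (C := ‖f‖)
    (fun _ => norm_le_pi_norm f _) s t

lemma decay_pos (s t : ℝ) : 0 < decay a x s t := Real.exp_pos _

@[simp] lemma decay_self (t : ℝ) : decay a x t t = 1 := by simp [decay]

lemma decay_mul (hx : ∀ f : Fin N → ℝ, Measurable fun u => f (x u)) (r s t : ℝ) :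
    decay a x r s * decay a x s t = decay a x r t := by
  rw [decay, decay, decay, ← Real.exp_add, intervalIntegral.integral_add_adjacent_intervals
    (intervalIntegrable_path hx a r s) (intervalIntegrable_path hx a s t)]

lemma decay_le_one (ha : ∀ i, a i ≤ 0) {s t : ℝ} (hst : s ≤ t) : decay a x s t ≤ 1 := by
  rw [decay, Real.exp_le_one_iff]
  have := intervalIntegral.integral_nonneg (μ := volume) (f := fun u => -a (x u.toNNReal)) hst
    fun u _ => neg_nonneg.2 (ha _)
  rw [intervalIntegral.integral_neg] at this
  linarith

lemma continuous_decay (hx : ∀ f : Fin N → ℝ, Measurable fun u => f (x u)) (t : ℝ) :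
    Continuous fun u => decay a x u t := by
  have : (fun u => decay a x u t) = fun u => Real.exp (-∫ r in t..u, a (x r.toNNReal)) := by
    funext u; rw [decay, intervalIntegral.integral_symm]
  rw [this]
  exact Real.continuous_exp.comp
    (intervalIntegral.continuous_primitive (intervalIntegrable_path hx a) t).neg

/-- The integrand is only right-continuous, so the fundamental theorem of calculus is applied with
right derivatives. -/
lemma decay_sub_decay (hc : RightConst x) (u v t : ℝ) :
    ∫ r in u..v, a (x r.toNNReal) * decay a x r t = decay a x u t - decay a x v t := by
  have hx := hc.measurable_comp
  have hcont := continuous_decay (a := a) hx t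
  have key : ∫ r in u..v, -(a (x r.toNNReal) * decay a x r t)
      = decay a x v t - decay a x u t := by
    refine intervalIntegral.integral_eq_sub_of_hasDeriv_right hcont.continuousOn
      (fun r _ => ?_) ?_
    · have h1 : HasDerivWithinAt (fun u => ∫ s in t..u, a (x s.toNNReal)) (a (x r.toNNReal))
          (Set.Ici r) r := by
        refine intervalIntegral.integral_hasDerivWithinAt_right (t := Set.Ioi r)
          (intervalIntegrable_path hx a t r) ?_ ?_
        · exact ⟨Set.univ, univ_mem, (measurable_path hx a).aestronglyMeasurable⟩
        · refine tendsto_const_nhds.congr' ?_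
          filter_upwards [hc.toNNReal r] with v hv using by rw [hv]
      have h2 := (h1.mono Set.Ioi_subset_Ici_self).neg.exp
      have e : ∀ u, decay a x u t = Real.exp (-∫ r in t..u, a (x r.toNNReal)) := fun u => by
        rw [decay, intervalIntegral.integral_symm]
      simp only [e]
      have e' : -(a (x r.toNNReal) * Real.exp (-∫ r in t..r, a (x r.toNNReal))) =
          Real.exp (-∫ r in t..r, a (x r.toNNReal)) * -a (x r.toNNReal) := by ring
      rw [e']
      exact h2
    · exact ((intervalIntegrable_path hx a u v).mul_continuousOn hcont.continuousOn).neg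
  rw [intervalIntegral.integral_neg] at key
  linarith

/-- Uniform continuity on a compact cube, comparing with the diagonal. Both mesh estimates below
apply it to the error on a single interval. -/
lemma exists_mesh_of_continuous {Φ : ℝ × ℝ × ℝ → ℝ} (hΦ : Continuous Φ)
    (h0 : ∀ u, Φ (u, u, u) = 0) (t : ℝ) {ε : ℝ} (hε : 0 < ε) :
    ∃ δ > 0, ∀ u v w, u ∈ Set.Icc 0 t → v ∈ Set.Icc 0 t → w ∈ Set.Icc 0 t →
      |v - u| < δ → |w - u| < δ → |Φ (u, v, w)| ≤ ε := by
  have hK : IsCompact (Set.Icc (0 : ℝ) t ×ˢ Set.Icc (0 : ℝ) t ×ˢ Set.Icc (0 : ℝ) t) :=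
    isCompact_Icc.prod (isCompact_Icc.prod isCompact_Icc)
  have hU := hK.uniformContinuousOn_of_continuous hΦ.continuousOn
  obtain ⟨δ, hδ, H⟩ := Metric.uniformContinuousOn_iff.1 hU ε hε
  refine ⟨δ, hδ, fun u v w hu hv hw h1 h2 => ?_⟩
  have := H (u, v, w) ⟨hu, hv, hw⟩ (u, u, u) ⟨hu, hu, hu⟩ (by
    simp [Prod.dist_eq, Real.dist_eq, h1, h2])
  rw [h0, dist_zero_right, Real.norm_eq_abs] at this
  exact this.le

/-- Variation of constants along subdivisions of small mesh. -/
lemma exists_mesh_variation_of_constants (hc : RightConst x) {y : ℝ≥0 → ℝ} (hy : Continuous y)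
    (t : ℝ≥0) {ε : ℝ} (hε : 0 < ε) :
    ∃ δ > 0, ∀ (n : ℕ) (τ : ℕ → ℝ≥0), τ 0 = 0 → τ n = t → Monotone τ →
      (∀ k < n, (τ (k + 1) : ℝ) - τ k < δ) →
      |∑ k ∈ Finset.range n, decay a x (τ k) t * (y (τ (k + 1)) - y (τ k)
        - ∫ u in (τ k : ℝ)..τ (k + 1), a (x u.toNNReal) * y u.toNNReal)
        - (y t - decay a x 0 t * y 0)| ≤ ‖a‖ * ε * t := by
  have hx := hc.measurable_comp
  set g : ℝ → ℝ := fun u => decay a x u t with hg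
  have hgc : Continuous g := continuous_decay hx t
  set z : ℝ → ℝ := fun u => y u.toNNReal with hz
  have hzc : Continuous z := hy.comp continuous_real_toNNReal
  have hzy : ∀ s : ℝ≥0, y s = z s := fun s => by simp [hz]
  -- Summation by parts: up to the factor `a (x u)`, this `Φ` is the integrand of the error on one
  -- interval, and it vanishes when the three times coincide.
  obtain ⟨δ, hδ, H⟩ := exists_mesh_of_continuous
    (Φ := fun p => z p.2.1 * g p.1 - g p.2.2 * z p.1) (by fun_prop)
    (fun u => by ring) t hε
  refine ⟨δ, hδ, fun n τ h0 hn hmono hmesh => ?_⟩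
  have htel : y t - decay a x 0 t * y 0 =
      ∑ k ∈ Finset.range n, (g (τ (k + 1)) * z (τ (k + 1)) - g (τ k) * z (τ k)) := by
    rw [Finset.sum_range_sub (fun k => g (τ k) * z (τ k)), h0, hn]
    simp [hg, hz]
  have hsum : (t : ℝ) = ∑ k ∈ Finset.range n, ((τ (k + 1) : ℝ) - τ k) := by
    rw [Finset.sum_range_sub (fun k => (τ k : ℝ)), h0, hn]; simp
  rw [htel, ← Finset.sum_sub_distrib]
  refine (Finset.abs_sum_le_sum_abs _ _).trans ?_
  conv_rhs => rw [hsum, Finset.mul_sum]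
  refine Finset.sum_le_sum fun k hk => ?_
  have hk := Finset.mem_range.1 hk
  have hm : (τ k : ℝ) ≤ τ (k + 1) := by exact_mod_cast hmono k.le_succ
  have ht : (τ (k + 1) : ℝ) ≤ t := by rw [← hn]; exact_mod_cast hmono hk
  have hτ0 := (τ k).coe_nonneg
  have hi1 := (intervalIntegrable_path hx a (τ k) (τ (k + 1))).mul_continuousOn hgc.continuousOn
  have hi2 := (intervalIntegrable_path hx a (τ k) (τ (k + 1))).mul_continuousOn hzc.continuousOn
  have hterm : decay a x (τ k) t * (y (τ (k + 1)) - y (τ k)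
        - ∫ u in (τ k : ℝ)..τ (k + 1), a (x u.toNNReal) * y u.toNNReal)
        - (g (τ (k + 1)) * z (τ (k + 1)) - g (τ k) * z (τ k)) =
      ∫ u in (τ k : ℝ)..τ (k + 1), a (x u.toNNReal) *
        (z (τ (k + 1)) * g u - g (τ k) * z u) := by
    have e : (fun u : ℝ => a (x u.toNNReal) * (z (τ (k + 1)) * g u - g (τ k) * z u)) =
        fun u => z (τ (k + 1)) * (a (x u.toNNReal) * g u)
          - g (τ k) * (a (x u.toNNReal) * z u) := by
      funext u; ring
    rw [e, intervalIntegral.integral_sub (hi1.const_mul _) (hi2.const_mul _),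
      intervalIntegral.integral_const_mul, intervalIntegral.integral_const_mul,
      decay_sub_decay hc, hzy, hzy]
    simp only [hg, hz]
    ring
  rw [hterm, ← Real.norm_eq_abs]
  refine (intervalIntegral.norm_integral_le_of_norm_le_const (C := ‖a‖ * ε) fun u hu => ?_).trans ?_
  · rw [Set.uIoc_of_le hm] at hu
    rw [norm_mul]
    refine mul_le_mul (norm_le_pi_norm a _) ?_ (norm_nonneg _) (norm_nonneg _)
    have hmk := hmesh k hk
    refine H u (τ (k + 1)) (τ k) ⟨by linarith [hu.1], hu.2.trans ht⟩ ⟨by linarith, ht⟩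
      ⟨hτ0, hm.trans ht⟩ ?_ ?_
    · rw [abs_of_nonneg (by linarith [hu.2])]; linarith [hu.1]
    · rw [abs_of_nonpos (by linarith [hu.1])]; linarith [hu.2]
  · rw [abs_of_nonneg (by linarith)]

/-- The variances of the elementary stochastic integrals converge to `condVar`. -/
lemma exists_mesh_condVar (hc : RightConst x) (t : ℝ≥0) {ε : ℝ} (hε : 0 < ε) :
    ∃ δ > 0, ∀ (n : ℕ) (τ : ℕ → ℝ≥0), IsSubdivision x t n τ →
      (∀ k < n, (τ (k + 1) : ℝ) - τ k < δ) →
      |∑ k ∈ Finset.range n, (decay a x (τ k) t * σ (x (τ k))) ^ 2 * ((τ (k + 1) : ℝ) - τ k)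
        - condVar a σ x t| ≤ ‖σ‖ ^ 2 * ε * t := by
  have hx := hc.measurable_comp
  set g : ℝ → ℝ := fun u => decay a x u t with hg
  have hgc : Continuous g := continuous_decay hx t
  obtain ⟨δ, hδ, H⟩ := exists_mesh_of_continuous
    (Φ := fun p => g p.2.2 ^ 2 - g p.1 ^ 2) (by fun_prop)
    (fun u => by ring) t hε
  refine ⟨δ, hδ, fun n τ hτ hmesh => ?_⟩
  have hi : ∀ s t, IntervalIntegrable (fun u => g u ^ 2 * σ (x u.toNNReal) ^ 2) volume s t :=
    fun s t => (intervalIntegrable_path hx (fun i => σ i ^ 2) s t).continuousOn_mul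
      (hgc.pow 2).continuousOn
  have hV : condVar a σ x t = ∑ k ∈ Finset.range n,
      ∫ u in (τ k : ℝ)..τ (k + 1), g u ^ 2 * σ (x u.toNNReal) ^ 2 := by
    rw [intervalIntegral.sum_integral_adjacent_intervals (a := fun k => (τ k : ℝ))
      (fun k _ => hi _ _), hτ.zero, hτ.last]
    rfl
  have hsum : (t : ℝ) = ∑ k ∈ Finset.range n, ((τ (k + 1) : ℝ) - τ k) := by
    rw [Finset.sum_range_sub (fun k => (τ k : ℝ)), hτ.zero, hτ.last]; simp
  rw [hV, ← Finset.sum_sub_distrib]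
  refine (Finset.abs_sum_le_sum_abs _ _).trans ?_
  conv_rhs => rw [hsum, Finset.mul_sum]
  refine Finset.sum_le_sum fun k hk => ?_
  have hk := Finset.mem_range.1 hk
  have hm : (τ k : ℝ) ≤ τ (k + 1) := by exact_mod_cast hτ.mono k.le_succ
  have ht : (τ (k + 1) : ℝ) ≤ t := by
    have := hτ.mono hk
    rw [hτ.last] at this
    exact_mod_cast this
  have hτ0 := (τ k).coe_nonneg
  have hterm : (decay a x (τ k) t * σ (x (τ k))) ^ 2 * ((τ (k + 1) : ℝ) - τ k)
      - ∫ u in (τ k : ℝ)..τ (k + 1), g u ^ 2 * σ (x u.toNNReal) ^ 2 =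
      ∫ u in (τ k : ℝ)..τ (k + 1), ((g (τ k) * σ (x (τ k))) ^ 2
        - g u ^ 2 * σ (x u.toNNReal) ^ 2) := by
    rw [intervalIntegral.integral_sub intervalIntegrable_const (hi _ _),
      intervalIntegral.integral_const, smul_eq_mul, mul_comm]
  rw [hterm, ← Real.norm_eq_abs]
  rcases hm.eq_or_lt with he | hlt
  · rw [he]; simp
  -- The path is constant on the half-open interval closed on the left, hence the passage from `Ioc`
  -- to `Ico`.
  rw [intervalIntegral.integral_of_le hm, ← integral_Ico_eq_integral_Ioc]
  refine (norm_setIntegral_le_of_norm_le_const (C := ‖σ‖ ^ 2 * ε) (by simp) fun u hu => ?_).trans ?_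
  · have hu0 : 0 ≤ u := hτ0.trans hu.1
    have e : x u.toNNReal = x (τ k) := hτ.const k hk _
      (by rw [← NNReal.coe_le_coe, Real.coe_toNNReal _ hu0]; exact hu.1)
      (by rw [← NNReal.coe_lt_coe, Real.coe_toNNReal _ hu0]; exact hu.2)
    rw [e, mul_pow, ← sub_mul, norm_mul, mul_comm]
    refine mul_le_mul ?_ ?_ (norm_nonneg _) (by positivity)
    · rw [norm_pow]
      gcongr
      exact norm_le_pi_norm σ _
    · have hmk := hmesh k hk
      refine H u u (τ k) ⟨hu0, hu.2.le.trans ht⟩ ⟨hu0, hu.2.le.trans ht⟩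
        ⟨hτ0, hm.trans ht⟩ ?_ ?_
      · simpa using hδ
      · rw [abs_of_nonpos (by linarith [hu.1])]; linarith [hu.2]
  · simp [measureReal_def, ENNReal.toReal_ofReal (sub_nonneg.2 hm)]

end Path

/-! ### The conditional law given the path of the jump process -/

section ConditionalLaw

/-- Brownian increments along a monotone sequence are independent and Gaussian, so the
characteristic functions multiply and the variances add. -/
lemma charFun_map_sum_increments {Θ : Type*} {mΘ : MeasurableSpace Θ} {Q' : Measure Θ}
    {W : ℝ≥0 → Θ → ℝ} (hW : IsPreBrownianReal W Q') {τ : ℕ → ℝ≥0} (hτ : Monotone τ)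
    (c : ℕ → ℝ) (n : ℕ) (ξ : ℝ) :
    charFun (Q'.map fun θ => ∑ k ∈ Finset.range n, c k * (W (τ (k + 1)) θ - W (τ k) θ)) ξ =
      Complex.exp (-(((∑ k ∈ Finset.range n, c k ^ 2 * ((τ (k + 1) : ℝ) - τ k) : ℝ) : ℂ)
        * (ξ : ℂ) ^ 2 / 2)) := by
  have hm : ∀ k, AEMeasurable (fun θ => W (τ (k + 1)) θ - W (τ k) θ) Q' := fun k =>
    (hW.aemeasurable _).sub (hW.aemeasurable _)
  have hind : iIndepFun (fun k θ => c k * (W (τ (k + 1)) θ - W (τ k) θ)) Q' :=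
    (hW.hasIndepIncrements.nat hτ).comp (fun k x => c k * x) fun k => measurable_const_mul (c k)
  rw [iIndepFun.charFun_map_fun_finsetSum_eq_prod
    (X := fun k θ => c k * (W (τ (k + 1)) θ - W (τ k) θ))
    (fun k _ => (hm k).const_mul (c k)) (hind.restrict _), Finset.prod_apply]
  have hone : ∀ k, charFun (Q'.map fun θ => c k * (W (τ (k + 1)) θ - W (τ k) θ)) ξ =
      Complex.exp (-(((c k ^ 2 * ((τ (k + 1) : ℝ) - τ k) : ℝ) : ℂ) * (ξ : ℂ) ^ 2 / 2)) := by
    intro k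
    have hlaw := hW.hasLaw_sub (τ (k + 1)) (τ k)
    have h1 : Q'.map (fun θ => c k * (W (τ (k + 1)) θ - W (τ k) θ)) =
        (Q'.map (W (τ (k + 1)) - W (τ k))).map (fun x => c k * x) := by
      rw [AEMeasurable.map_map_of_aemeasurable (by fun_prop) hlaw.aemeasurable]
      rfl
    have hd : ((nndist (τ (k + 1) : ℝ) (τ k) : ℝ≥0) : ℝ) = (τ (k + 1) : ℝ) - τ k := by
      rw [coe_nndist, Real.dist_eq, abs_of_nonneg]
      exact sub_nonneg.2 (by exact_mod_cast hτ k.le_succ)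
    obtain ⟨v, hv, hlaw'⟩ : ∃ v : ℝ≥0, (v : ℝ) = (τ (k + 1) : ℝ) - τ k ∧
        Q'.map (W (τ (k + 1)) - W (τ k)) = gaussianReal 0 v := ⟨_, hd, hlaw.map_eq⟩
    rw [h1, hlaw', gaussianReal_map_const_mul, charFun_gaussianReal, ← hv]
    congr 1
    simp
  simp only [hone]
  rw [← Complex.exp_sum]
  congr 1
  rw [Complex.ofReal_sum, Finset.sum_mul, Finset.sum_div, Finset.sum_neg_distrib]

variable {N : ℕ} {a σ : Fin N → ℝ} {x : ℝ≥0 → Fin N}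

lemma condVar_nonneg (t : ℝ≥0) : 0 ≤ condVar a σ x t :=
  intervalIntegral.integral_nonneg t.coe_nonneg fun u _ => by positivity

lemma IsSubdivision.exists_seq {E : Type*} {x : ℝ≥0 → E} {t : ℝ≥0}
    (h : ∃ n τ, IsSubdivision x t n τ) :
    ∃ (n : ℕ → ℕ) (τ : ℕ → ℕ → ℝ≥0), (∀ m, IsSubdivision x t (n m) (τ m)) ∧
      ∀ δ > 0, ∀ᶠ m in atTop, ∀ k < n m, (τ m (k + 1) : ℝ) - τ m k < δ := by
  obtain ⟨n, τ, h⟩ := h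
  choose n' τ' h' hm using h.exists_mesh_le
  refine ⟨n', τ', h', fun δ hδ => ?_⟩
  have hlim : Tendsto (fun m : ℕ => (t : ℝ) / 2 ^ m) atTop (𝓝 0) :=
    tendsto_const_nhds.div_atTop (tendsto_pow_atTop_atTop_of_one_lt one_lt_two)
  filter_upwards [hlim.eventually (gt_mem_nhds hδ)] with m hlt k hk
  exact (hm m k hk).trans_lt hlt

/-- For a frozen path of the jump process, the solution minus the contribution of the initial
condition is a centered Gaussian variable of variance `condVar`. -/
lemma hasLaw_sub_decay_mul {Θ : Type*} {mΘ : MeasurableSpace Θ} {Q' : Measure Θ}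
    [IsProbabilityMeasure Q'] {W : ℝ≥0 → Θ → ℝ} (hW : IsPreBrownianReal W Q')
    (hx : ∀ t, ∃ n τ, IsSubdivision x t n τ) {y : ℝ≥0 → Θ → ℝ}
    (hy : ∀ᵐ θ ∂Q', Continuous fun t => y t θ)
    (hsde : ∀ᵐ θ ∂Q', ∀ (t : ℝ≥0) (n : ℕ) (τ : ℕ → ℝ≥0), IsSubdivision x t n τ →
      y t θ = y 0 θ + (∫ u in (0 : ℝ)..t, a (x u.toNNReal) * y u.toNNReal θ)
        + ∑ k ∈ Finset.range n, σ (x (τ k)) * (W (τ (k + 1)) θ - W (τ k) θ)) (t : ℝ≥0) :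
    HasLaw (fun θ => y t θ - decay a x 0 t * y 0 θ)
      (gaussianReal 0 (condVar a σ x t).toNNReal) Q' := by
  have hc := RightConst.of_subdivision hx
  have hxm := hc.measurable_comp
  obtain ⟨n, τ, hτ, hmesh⟩ := IsSubdivision.exists_seq (hx t)
  set D : Θ → ℝ := fun θ => y t θ - decay a x 0 t * y 0 θ with hD
  set S : ℕ → Θ → ℝ := fun m θ => ∑ k ∈ Finset.range (n m),
    (decay a x (τ m k) t * σ (x (τ m k))) * (W (τ m (k + 1)) θ - W (τ m k) θ) with hS
  have hSm : ∀ m, AEMeasurable (S m) Q' := fun m =>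
    Finset.aemeasurable_fun_sum _ fun k _ =>
      ((hW.aemeasurable _).sub (hW.aemeasurable _)).const_mul _
  have hlim : ∀ᵐ θ ∂Q', Tendsto (fun m => S m θ) atTop (𝓝 (D θ)) := by
    filter_upwards [hy, hsde] with θ hyc hs
    have hzc : Continuous fun u : ℝ => y u.toNNReal θ := hyc.comp continuous_real_toNNReal
    have hi : ∀ r s, IntervalIntegrable (fun u : ℝ => a (x u.toNNReal) * y u.toNNReal θ)
        volume r s := fun r s =>
      (intervalIntegrable_path hxm a r s).mul_continuousOn hzc.continuousOn
    -- Subtracting the equations along the subdivisions truncated at `τ m k` and at `τ m (k + 1)`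
    -- isolates one Brownian term.
    have hSθ : ∀ m, S m θ = ∑ k ∈ Finset.range (n m), decay a x (τ m k) t *
        (y (τ m (k + 1)) θ - y (τ m k) θ
          - ∫ u in (τ m k : ℝ)..τ m (k + 1), a (x u.toNNReal) * y u.toNNReal θ) := by
      intro m
      refine Finset.sum_congr rfl fun k hk => ?_
      have hk := Finset.mem_range.1 hk
      have h1 := hs _ _ _ ((hτ m).truncate hk.le)
      have h2 := hs _ _ _ ((hτ m).truncate (Nat.succ_le_of_lt hk))
      rw [Finset.sum_range_succ, Nat.succ_eq_add_one,
        ← intervalIntegral.integral_add_adjacent_intervals (hi 0 (τ m k)) (hi _ _)] at h2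
      rw [mul_assoc]
      congr 1
      rw [h1, h2]
      ring
    simp only [hSθ]
    rw [Metric.tendsto_atTop']
    intro ε hε
    -- The added 1 keeps the divisor positive when `‖a‖ * t` is zero.
    have hpos : 0 < ‖a‖ * t + 1 := by positivity
    obtain ⟨δ, hδ, H⟩ := exists_mesh_variation_of_constants (a := a) hc hyc t
      (div_pos hε hpos)
    obtain ⟨m₀, hm₀⟩ := eventually_atTop.1 (hmesh δ hδ)
    refine ⟨m₀, fun m hm => ?_⟩
    rw [Real.dist_eq]
    refine (H _ _ (hτ m).zero (hτ m).last (hτ m).mono (hm₀ m hm.le)).trans_lt ?_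
    rw [mul_div_assoc', div_mul_eq_mul_div, div_lt_iff₀ hpos]
    nlinarith
  have hDm : AEMeasurable D Q' := aemeasurable_of_tendsto_metrizable_ae atTop hSm hlim
  refine ⟨hDm, ?_⟩
  have := Measure.isProbabilityMeasure_map hDm
  -- The characteristic functions of `S m` converge both to that of `D`, by dominated convergence,
  -- and to the Gaussian one, by convergence of the variances.
  refine Measure.ext_of_charFun (funext fun ξ => ?_)
  have hleft : Tendsto (fun m => charFun (Q'.map (S m)) ξ) atTop (𝓝 (charFun (Q'.map D) ξ)) := by
    simp only [charFun_apply_real]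
    have hinteg : ∀ {f : Θ → ℝ}, AEMeasurable f Q' →
        ∫ r, Complex.exp (ξ * r * Complex.I) ∂(Q'.map f) =
          ∫ θ, Complex.exp (ξ * f θ * Complex.I) ∂Q' := fun hf =>
      integral_map hf (Measurable.aestronglyMeasurable (by fun_prop))
    simp only [hinteg (hSm _), hinteg hDm]
    refine tendsto_integral_of_dominated_convergence (fun _ => 1)
      (fun m => ?_) (integrable_const 1) (fun m => ?_) ?_
    · have h := hSm m
      exact AEMeasurable.aestronglyMeasurable (by fun_prop)
    · refine Eventually.of_forall fun θ => ?_
      rw [← Complex.ofReal_mul, Complex.norm_exp_ofReal_mul_I]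
    · filter_upwards [hlim] with θ hθ
      have hcont : Continuous fun r : ℝ => Complex.exp (ξ * r * Complex.I) := by fun_prop
      exact (hcont.tendsto _).comp hθ
  have hvar : Tendsto (fun m => ∑ k ∈ Finset.range (n m),
      (decay a x (τ m k) t * σ (x (τ m k))) ^ 2 * ((τ m (k + 1) : ℝ) - τ m k)) atTop
      (𝓝 (condVar a σ x t)) := by
    rw [Metric.tendsto_atTop']
    intro ε hε
    have hpos : 0 < ‖σ‖ ^ 2 * t + 1 := by positivity
    obtain ⟨δ, hδ, H⟩ := exists_mesh_condVar (a := a) (σ := σ) hc t (div_pos hε hpos)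
    obtain ⟨m₀, hm₀⟩ := eventually_atTop.1 (hmesh δ hδ)
    refine ⟨m₀, fun m hm => ?_⟩
    rw [Real.dist_eq]
    refine (H _ _ (hτ m) (hm₀ m hm.le)).trans_lt ?_
    rw [mul_div_assoc', div_mul_eq_mul_div, div_lt_iff₀ hpos]
    nlinarith
  have hright : Tendsto (fun m => charFun (Q'.map (S m)) ξ) atTop
      (𝓝 (charFun (gaussianReal 0 (condVar a σ x t).toNNReal) ξ)) := by
    simp only [hS, charFun_map_sum_increments hW (hτ _).mono
      (fun k => decay a x (τ _ k) t * σ (x (τ _ k)))]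
    rw [charFun_gaussianReal, Real.coe_toNNReal _ (condVar_nonneg t)]
    have hcont : Continuous fun v : ℝ => Complex.exp (-((v : ℂ) * (ξ : ℂ) ^ 2 / 2)) := by fun_prop
    have e : (ξ : ℂ) * ((0 : ℝ) : ℂ) * Complex.I - (condVar a σ x t : ℂ) * (ξ : ℂ) ^ 2 / 2 =
        -((condVar a σ x t : ℂ) * (ξ : ℂ) ^ 2 / 2) := by simp
    rw [e]
    exact (hcont.tendsto (condVar a σ x t)).comp hvar
  exact tendsto_nhds_unique hleft hright

end ConditionalLaw

/-! ### The transition semigroup -/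

section Transition

variable {N : ℕ}

lemma hasSum_exp_apply (A : Matrix (Fin N) (Fin N) ℝ) (i j : Fin N) :
    HasSum (fun n : ℕ => ((n.factorial : ℝ)⁻¹) * (A ^ n) i j) (NormedSpace.exp A i j) := by
  let : NormedRing (Matrix (Fin N) (Fin N) ℝ) := Matrix.linftyOpNormedRing
  let : NormedAlgebra ℝ (Matrix (Fin N) (Fin N) ℝ) := Matrix.linftyOpNormedAlgebra
  have h := NormedSpace.exp_series_hasSum_exp' (𝕂 := ℝ) A
  exact Pi.hasSum.1 (Pi.hasSum.1 h i) j

lemma pow_div_factorial_le_exp_apply {B : Matrix (Fin N) (Fin N) ℝ} (hB : ∀ i j, 0 ≤ B i j)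
    (k : ℕ) (i j : Fin N) : ((k.factorial : ℝ)⁻¹) * (B ^ k) i j ≤ NormedSpace.exp B i j :=
  le_hasSum (hasSum_exp_apply B i j) k fun n _ =>
    mul_nonneg (by positivity) (Matrix.pow_apply_nonneg hB n i j)

lemma sum_exp_apply_of_row_sum_eq_zero {A : Matrix (Fin N) (Fin N) ℝ}
    (hA : ∀ i, ∑ j, A i j = 0) (i : Fin N) : ∑ j, NormedSpace.exp A i j = 1 := by
  have h1 := hasSum_sum (s := Finset.univ) fun j _ => hasSum_exp_apply A i j
  -- Positive powers of `A` inherit zero row sums, so only the term of order 0 contributes.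
  have h2 : HasSum (fun n : ℕ => ∑ j, ((n.factorial : ℝ)⁻¹) * (A ^ n) i j) 1 := by
    convert hasSum_single (f := fun n : ℕ => ∑ j, ((n.factorial : ℝ)⁻¹) * (A ^ n) i j) 0 ?_
    · simp [Matrix.one_apply]
    · intro n hn
      obtain ⟨m, rfl⟩ := Nat.exists_eq_succ_of_ne_zero hn
      rw [← Finset.mul_sum]
      simp only [Nat.succ_eq_add_one, pow_succ, Matrix.mul_apply]
      rw [Finset.sum_comm]
      simp [← Finset.mul_sum, hA]
  exact h1.unique h2

lemma pow_le_pow_apply {A B : Matrix (Fin N) (Fin N) ℝ} (hA : ∀ i j, 0 ≤ A i j)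
    (hAB : ∀ i j, A i j ≤ B i j) (k : ℕ) (i j : Fin N) : (A ^ k) i j ≤ (B ^ k) i j := by
  induction k generalizing i j with
  | zero => simp
  | succ k ih =>
    simp only [pow_succ, Matrix.mul_apply]
    refine Finset.sum_le_sum fun l _ => mul_le_mul (ih i l) (hAB l j) (hA l j)
      ((Matrix.pow_apply_nonneg hA k i l).trans (ih i l))

variable {lam : Fin N → ℝ} {q : Matrix (Fin N) (Fin N) ℝ}

lemma generator_apply (i j : Fin N) :
    generator lam q i j = lam i * q i j - if i = j then lam i else 0 := by
  simp only [generator, Matrix.diagonal_mul, Matrix.sub_apply, Matrix.one_apply, mul_sub]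
  split_ifs <;> simp

/-- Uniformization: adding a scalar matrix that dominates every intensity makes the generator
entrywise nonnegative, and its exponential factors out because scalars commute. Positivity can then
be read off the exponential series term by term. -/
lemma transition_eq_smul_exp (t : ℝ≥0) :
    transition lam q t = Real.exp (-(t * ∑ i, lam i)) •
      NormedSpace.exp ((t : ℝ) • (generator lam q + (∑ i, lam i) • 1)) := by
  have hsplit : (t : ℝ) • generator lam q = (-(t * ∑ i, lam i)) • (1 : Matrix (Fin N) (Fin N) ℝ)
      + (t : ℝ) • (generator lam q + (∑ i, lam i) • 1) := by
    rw [smul_add, smul_smul, neg_smul]; abel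
  rw [transition, hsplit, Matrix.exp_add_of_commute _ _ ((Commute.one_left _).smul_left _)]
  have hd : (-(t * ∑ i, lam i)) • (1 : Matrix (Fin N) (Fin N) ℝ) =
      Matrix.diagonal fun _ => -(t * ∑ i, lam i) := by
    rw [← Matrix.diagonal_one, ← Matrix.diagonal_smul]
    congr 1
    funext i
    simp
  rw [hd, Matrix.exp_diagonal]
  ext i j
  rw [Matrix.diagonal_mul, Matrix.smul_apply, smul_eq_mul, Pi.coe_exp, ← Real.exp_eq_exp_ℝ]

lemma mul_le_generator_add (hlam : ∀ i, 0 < lam i) (i j : Fin N) :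
    lam i * q i j ≤ (generator lam q + (∑ i, lam i) • (1 : Matrix (Fin N) (Fin N) ℝ)) i j := by
  have hle : lam i ≤ ∑ i, lam i :=
    Finset.single_le_sum (fun j _ => (hlam j).le) (Finset.mem_univ i)
  rw [Matrix.add_apply, Matrix.smul_apply, generator_apply, Matrix.one_apply]
  split_ifs
  · simp; linarith
  · simp

lemma transition_nonneg (hlam : ∀ i, 0 < lam i) (hq : q ∈ Matrix.rowStochastic ℝ (Fin N))
    (t : ℝ≥0) (i j : Fin N) : 0 ≤ transition lam q t i j := by
  rw [transition_eq_smul_exp, Matrix.smul_apply, smul_eq_mul]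
  refine mul_nonneg (Real.exp_nonneg _) ?_
  have hB : ∀ i j, 0 ≤ ((t : ℝ) • (generator lam q +
      (∑ i, lam i) • (1 : Matrix (Fin N) (Fin N) ℝ))) i j := fun i j => by
    rw [Matrix.smul_apply, smul_eq_mul]
    exact mul_nonneg t.coe_nonneg ((mul_nonneg (hlam i).le
      (Matrix.nonneg_of_mem_rowStochastic hq)).trans (mul_le_generator_add hlam i j))
  exact (mul_nonneg (by positivity) (Matrix.pow_apply_nonneg hB 0 i j)).trans
    (pow_div_factorial_le_exp_apply hB 0 i j)

lemma sum_transition (hq : q ∈ Matrix.rowStochastic ℝ (Fin N)) (t : ℝ≥0) (i : Fin N) :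
    ∑ j, transition lam q t i j = 1 := by
  refine sum_exp_apply_of_row_sum_eq_zero (fun i => ?_) i
  simp only [Matrix.smul_apply, smul_eq_mul, generator_apply, ← Finset.mul_sum,
    Finset.sum_sub_distrib, Matrix.sum_row_of_mem_rowStochastic hq]
  simp

/-- Irreducibility provides a power of `q` with positive entry at `(i, j)`. The shifted generator
dominates `min lam` times `q`, so the same power of it is positive there, and a single term of the
series suffices. -/
lemma transition_one_pos (hlam : ∀ i, 0 < lam i) (hq : q ∈ Matrix.rowStochastic ℝ (Fin N))
    (hirr : q.IsIrreducible) (i j : Fin N) : 0 < transition lam q 1 i j := by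
  have hq0 : ∀ i j, 0 ≤ q i j := fun i j => Matrix.nonneg_of_mem_rowStochastic hq
  obtain ⟨k, -, hk⟩ := (Matrix.isIrreducible_iff_exists_pow_pos hq0).1 hirr i j
  have : Nonempty (Fin N) := ⟨i⟩
  obtain ⟨l, hl⟩ := Finite.exists_min lam
  set B := generator lam q + (∑ i, lam i) • (1 : Matrix (Fin N) (Fin N) ℝ) with hBdef
  have hlq : ∀ i j, 0 ≤ (lam l • q) i j := fun i j => mul_nonneg (hlam l).le (hq0 i j)
  have hle : ∀ i j, (lam l • q) i j ≤ B i j := fun i j =>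
    (mul_le_mul_of_nonneg_right (hl i) (hq0 i j)).trans (mul_le_generator_add hlam i j)
  have hB : ∀ i j, 0 ≤ B i j := fun i j => (hlq i j).trans (hle i j)
  have hpow : 0 < (B ^ k) i j := by
    refine lt_of_lt_of_le ?_ (pow_le_pow_apply hlq hle k i j)
    rw [smul_pow, Matrix.smul_apply, smul_eq_mul]
    exact mul_pos (pow_pos (hlam l) k) hk
  rw [transition_eq_smul_exp, Matrix.smul_apply, smul_eq_mul, NNReal.coe_one, one_smul]
  exact mul_pos (Real.exp_pos _) (lt_of_lt_of_le (mul_pos (by positivity) hpow)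
    (pow_div_factorial_le_exp_apply hB k i j))

/-- A uniform contraction for functions valued in `[0, 1]` that are not identically one. -/
lemma exists_transition_mul_le (hlam : ∀ i, 0 < lam i)
    (hq : q ∈ Matrix.rowStochastic ℝ (Fin N)) (hirr : q.IsIrreducible) {f : Fin N → ℝ}
    (hf0 : ∀ i, 0 ≤ f i) (hf1 : ∀ i, f i ≤ 1) {l : Fin N} (hl : f l < 1) :
    ∃ ρ, 0 < ρ ∧ ρ < 1 ∧ ∀ i, ∑ j, transition lam q 1 i j * f j ≤ ρ := by
  have : Nonempty (Fin N) := ⟨l⟩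
  have hlt : ∀ i, ∑ j, transition lam q 1 i j * f j < 1 := fun i => by
    rw [← sum_transition (lam := lam) hq 1 i]
    refine Finset.sum_lt_sum (fun j _ => ?_) ⟨l, Finset.mem_univ l, ?_⟩
    · exact mul_le_of_le_one_right (transition_nonneg hlam hq 1 i j) (hf1 j)
    · exact mul_lt_of_lt_one_right (transition_one_pos hlam hq hirr i l) hl
  obtain ⟨m, hm⟩ := Finite.exists_max fun i => ∑ j, transition lam q 1 i j * f j
  have hm0 : 0 ≤ ∑ j, transition lam q 1 m j * f j :=
    Finset.sum_nonneg fun j _ => mul_nonneg (transition_nonneg hlam hq 1 m j) (hf0 j)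
  have hm1 := hlt m
  -- The midpoint between the largest mean and 1 is positive even if that mean is 0.
  exact ⟨(1 + ∑ j, transition lam q 1 m j * f j) / 2, by linarith, by linarith,
    fun i => (hm i).trans (by linarith)⟩

end Transition

/-! ### Finite-dimensional laws -/

section FiniteDimensional

variable {N : ℕ} {lam : Fin N → ℝ} {q : Matrix (Fin N) (Fin N) ℝ} {mu : Fin N → ℝ}
  {Ω : Type*} [MeasurableSpace Ω] {Q : Measure Ω} [IsProbabilityMeasure Q]
  {X : ℝ≥0 → Ω → Fin N}

/-- The finite-dimensional laws started at an arbitrary time. -/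
lemma measureReal_forall_eq (hmu : IsInvariantProbability lam q mu)
    (hX : IsMarkovJumpProcess lam q mu Q X) (n : ℕ) {t : ℕ → ℝ≥0} (ht : Monotone t)
    (i : ℕ → Fin N) :
    Q.real {ω | ∀ k ≤ n, X (t k) ω = i k} =
      mu (i 0) * ∏ k ∈ Finset.range n, transition lam q (t (k + 1) - t k) (i k) (i (k + 1)) := by
  -- The field `law` covers only times starting at 0. Time 0 is prepended, and summing over the
  -- state there replaces `mu` by `mu` times the transition matrix, which is `mu` by invariance.
  set t' : ℕ → ℝ≥0 := fun k => Nat.casesOn k 0 t with ht'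
  have hmono : Monotone t' := by
    refine monotone_nat_of_le_succ fun k => ?_
    cases k with
    | zero => simp [ht']
    | succ k => exact ht k.le_succ
  have hlaw : ∀ j : Fin N, Q.real {ω | X 0 ω = j ∧ ∀ k ≤ n, X (t k) ω = i k} =
      mu j * (transition lam q (t 0) j (i 0) *
        ∏ k ∈ Finset.range n, transition lam q (t (k + 1) - t k) (i k) (i (k + 1))) := by
    intro j
    set i' : ℕ → Fin N := fun k => Nat.casesOn k j i with hi'
    have h : Q.real {ω | ∀ k ≤ n + 1, X (t' k) ω = i' k} =
        mu j * ((∏ k ∈ Finset.range n, transition lam q (t (k + 1) - t k) (i k) (i (k + 1))) *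
          transition lam q (t 0 - 0) j (i 0)) := by
      have h0 := hX.law (n + 1) t' i' rfl hmono
      rw [Finset.prod_range_succ'] at h0
      exact h0
    rw [tsub_zero] at h
    rw [mul_comm (transition lam q (t 0) j (i 0)), ← h]
    congr 1
    ext ω
    constructor
    · rintro ⟨h0, h1⟩ k hk
      cases k with
      | zero => exact h0
      | succ k => exact h1 k (by omega)
    · intro h
      exact ⟨h 0 (by omega), fun k hk => h (k + 1) (by omega)⟩
  have hunion : {ω | ∀ k ≤ n, X (t k) ω = i k} =
      ⋃ j, {ω | X 0 ω = j ∧ ∀ k ≤ n, X (t k) ω = i k} := by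
    ext ω; simp
  have hmeas : ∀ j, MeasurableSet {ω | X 0 ω = j ∧ ∀ k ≤ n, X (t k) ω = i k} := fun j => by
    refine (hX.measurable 0 (measurableSet_singleton j)).inter ?_
    have e : {ω | ∀ k ≤ n, X (t k) ω = i k} = ⋂ k, ⋂ _ : k ≤ n, X (t k) ⁻¹' {i k} := by
      ext ω; simp
    change MeasurableSet {ω | ∀ k ≤ n, X (t k) ω = i k}
    rw [e]
    exact MeasurableSet.iInter fun k => MeasurableSet.iInter fun _ =>
      hX.measurable (t k) (measurableSet_singleton (i k))
  rw [hunion, measureReal_iUnion_fintype ?_ hmeas]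
  · simp only [hlaw]
    simp only [← mul_assoc]
    rw [← Finset.sum_mul]
    congr 1
    exact congrFun (hmu.invariant (t 0)) (i 0)
  · intro j j' hj
    refine Set.disjoint_left.2 fun ω h h' => hj ?_
    exact h.1.symm.trans h'.1

/-- The weight of a finite path in the finite-dimensional law at times `t 0 ≤ ... ≤ t n`. -/
def pathWeight (lam : Fin N → ℝ) (q : Matrix (Fin N) (Fin N) ℝ) (mu : Fin N → ℝ) (t : ℕ → ℝ≥0)
    (n : ℕ) (i : Fin (n + 1) → Fin N) : ℝ :=
  mu (i 0) * ∏ k : Fin n, transition lam q (t (k + 1) - t k) (i k.castSucc) (i k.succ)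

lemma integral_sample (hmu : IsInvariantProbability lam q mu)
    (hX : IsMarkovJumpProcess lam q mu Q X) (n : ℕ) {t : ℕ → ℝ≥0} (ht : Monotone t)
    (g : (Fin (n + 1) → Fin N) → ℝ) :
    ∫ ω, g (fun k => X (t k) ω) ∂Q = ∑ i, pathWeight lam q mu t n i * g i := by
  have hm : Measurable fun ω => fun k : Fin (n + 1) => X (t k) ω :=
    measurable_pi_lambda _ fun k => hX.measurable _
  have := Measure.isProbabilityMeasure_map (μ := Q) hm.aemeasurable
  rw [← integral_map (f := g) hm.aemeasurable (Measurable.of_discrete).aestronglyMeasurable,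
    integral_fintype Integrable.of_finite]
  refine Finset.sum_congr rfl fun i _ => ?_
  rw [smul_eq_mul, map_measureReal_apply hm (measurableSet_singleton i)]
  congr 1
  have h := measureReal_forall_eq hmu hX n ht (fun k => if h : k < n + 1 then i ⟨k, h⟩ else i 0)
  have e : (fun ω => fun k : Fin (n + 1) => X (t k) ω) ⁻¹' {i} =
      {ω | ∀ k ≤ n, X (t k) ω = if h : k < n + 1 then i ⟨k, h⟩ else i 0} := by
    ext ω
    simp only [Set.mem_preimage, Set.mem_singleton_iff, funext_iff, Set.mem_ofPred_eq]
    constructor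
    · intro h k hk
      rw [dif_pos (by omega)]
      exact h ⟨k, by omega⟩
    · intro h k
      have := h k (by omega)
      rwa [dif_pos k.2] at this
  rw [e, h, pathWeight, Finset.prod_range]
  congr 1
  refine Finset.prod_congr rfl fun k _ => ?_
  rw [dif_pos (by omega), dif_pos (by omega)]
  rfl

/-- Stationarity of the finite-dimensional laws. -/
lemma integral_sample_shift (hmu : IsInvariantProbability lam q mu)
    (hX : IsMarkovJumpProcess lam q mu Q X) (n : ℕ) {t : ℕ → ℝ≥0} (ht : Monotone t)
    (g : (Fin (n + 1) → Fin N) → ℝ) (s : ℝ≥0) :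
    ∫ ω, g (fun k => X (s + t k) ω) ∂Q = ∫ ω, g (fun k => X (t k) ω) ∂Q := by
  rw [integral_sample hmu hX n ht, integral_sample hmu hX n (t := fun k => s + t k)
    fun i j hij => add_le_add le_rfl (ht hij)]
  simp only [pathWeight, add_tsub_add_eq_tsub_left]

/-- Summing out the last state costs a factor `ρ`. There are `n + 1` states but only `n`
transitions: the factor of the initial state is merely bounded by 1. -/
lemma sum_pathWeight_mul_prod_le (hlam : ∀ i, 0 < lam i)
    (hq : q ∈ Matrix.rowStochastic ℝ (Fin N)) (hmu : IsInvariantProbability lam q mu)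
    {f : Fin N → ℝ} (hf0 : ∀ i, 0 ≤ f i) (hf1 : ∀ i, f i ≤ 1) {ρ : ℝ}
    (hf : ∀ i, ∑ j, transition lam q 1 i j * f j ≤ ρ) {t : ℕ → ℝ≥0}
    (ht : ∀ k, t (k + 1) - t k = 1) (n : ℕ) :
    ∑ i, pathWeight lam q mu t n i * ∏ k, f (i k) ≤ ρ ^ n := by
  have hmu0 : ∀ i, 0 ≤ mu i := fun i => hmu.mem_stdSimplex.1 i
  have hρ : 0 ≤ ρ := by
    by_contra! h
    obtain ⟨i⟩ : Nonempty (Fin N) := by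
      by_contra hN
      rw [not_nonempty_iff] at hN
      have := hmu.mem_stdSimplex.2
      simp at this
    exact absurd ((Finset.sum_nonneg fun j _ =>
      mul_nonneg (transition_nonneg hlam hq 1 i j) (hf0 j)).trans (hf i)) (not_le.2 h)
  have hw : ∀ n i, 0 ≤ pathWeight lam q mu t n i := fun n i =>
    mul_nonneg (hmu0 _) (Finset.prod_nonneg fun k _ => transition_nonneg hlam hq _ _ _)
  induction n with
  | zero =>
    rw [← (Equiv.funUnique (Fin 1) (Fin N)).symm.sum_comp]
    simp only [pathWeight, Finset.univ_eq_empty, Finset.prod_empty, mul_one, pow_zero]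
    refine le_trans (Finset.sum_le_sum (g := fun i => mu i) fun i _ => ?_)
      hmu.mem_stdSimplex.2.le
    simpa using mul_le_of_le_one_right (hmu0 i) (hf1 i)
  | succ n ih =>
    rw [← (Fin.snocEquiv fun _ : Fin (n + 2) => Fin N).sum_comp, Fintype.sum_prod_type_right,
      pow_succ]
    refine le_trans ?_ (mul_le_mul_of_nonneg_right ih hρ)
    rw [Finset.sum_mul]
    refine Finset.sum_le_sum fun i _ => ?_
    have hterm : ∀ j : Fin N, pathWeight lam q mu t (n + 1)
        (Fin.snocEquiv (fun _ : Fin (n + 2) => Fin N) (j, i)) *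
          ∏ k, f (Fin.snocEquiv (fun _ : Fin (n + 2) => Fin N) (j, i) k) =
        (pathWeight lam q mu t n i * ∏ k, f (i k)) *
          (transition lam q 1 (i (Fin.last n)) j * f j) := by
      intro j
      have e0 : (Fin.snoc i j : Fin (n + 2) → Fin N) 0 = i 0 := by
        rw [← Fin.castSucc_zero, Fin.snoc_castSucc (α := fun _ => Fin N)]
      have e1 : ∀ k : Fin (n + 1), (Fin.snoc i j : Fin (n + 2) → Fin N) k.castSucc = i k :=
        fun k => Fin.snoc_castSucc (α := fun _ => Fin N) _ _ _
      have e2 : (Fin.snoc i j : Fin (n + 2) → Fin N) (Fin.last (n + 1)) = j :=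
        Fin.snoc_last (α := fun _ => Fin N) _ _
      have e3 : ∀ k : Fin n,
          (Fin.snoc i j : Fin (n + 2) → Fin N) (k.castSucc).succ = i k.succ := fun k => by
        rw [Fin.succ_castSucc, e1]
      have e4 : (Fin.snoc i j : Fin (n + 2) → Fin N) (Fin.last n).succ = j := by
        rw [Fin.succ_last, e2]
      simp only [Fin.snocEquiv, Equiv.coe_fn_mk, pathWeight]
      rw [Fin.prod_univ_castSucc (n := n), Fin.prod_univ_castSucc (n := n + 1)]
      simp only [e0, e1, e2, e3, e4, ht]
      ring
    simp only [hterm]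
    rw [← Finset.mul_sum]
    exact mul_le_mul_of_nonneg_left (hf _)
      (mul_nonneg (hw n i) (Finset.prod_nonneg fun k _ => hf0 _))

end FiniteDimensional

/-! ### Path functionals: shift, discretization and measurability -/

section PathFunctionals

variable {N : ℕ} {a σ : Fin N → ℝ} {x : ℝ≥0 → Fin N}

lemma toNNReal_add_coe (s : ℝ≥0) {r : ℝ} (hr : 0 ≤ r) :
    ((s : ℝ) + r).toNNReal = s + r.toNNReal := by
  rw [Real.toNNReal_add s.coe_nonneg hr, Real.toNNReal_coe]

lemma decay_shift (s : ℝ≥0) {u t : ℝ} (hu : 0 ≤ u) (ht : 0 ≤ t) :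
    decay a (fun r => x (s + r)) u t = decay a x (s + u) (s + t) := by
  rw [decay, decay, ← intervalIntegral.integral_comp_add_left]
  congr 1
  refine intervalIntegral.integral_congr fun r hr => ?_
  have hr0 : 0 ≤ r := (le_min hu ht).trans hr.1
  simp only [toNNReal_add_coe s hr0]

lemma intervalIntegrable_condVar (hx : ∀ f : Fin N → ℝ, Measurable fun u => f (x u))
    (r s t : ℝ) :
    IntervalIntegrable (fun u => decay a x u t ^ 2 * σ (x u.toNNReal) ^ 2) volume r s :=
  (intervalIntegrable_path hx (fun i => σ i ^ 2) r s).continuousOn_mul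
      ((continuous_decay hx t).pow 2).continuousOn

/-- The integral splits at `s`: the late part is exactly the variance along the shifted path, the
early part is nonnegative. -/
lemma condVar_shift_le (hx : ∀ f : Fin N → ℝ, Measurable fun u => f (x u)) (s t : ℝ≥0) :
    condVar a σ (fun r => x (s + r)) t ≤ condVar a σ x (s + t) := by
  have hi := intervalIntegrable_condVar (a := a) (σ := σ) hx
  have h1 : condVar a σ x (s + t) = (∫ u in (0 : ℝ)..s, decay a x u (s + t) ^ 2 *
      σ (x u.toNNReal) ^ 2) + condVar a σ (fun r => x (s + r)) t := by
    rw [condVar, ← intervalIntegral.integral_add_adjacent_intervals (hi 0 s _) (hi s _ _)]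
    congr 1
    rw [condVar]
    have h2 := intervalIntegral.integral_comp_add_left (a := 0) (b := t)
      (fun u : ℝ => decay a x u (s + t) ^ 2 * σ (x u.toNNReal) ^ 2) (s : ℝ)
    rw [add_zero] at h2
    rw [← h2]
    refine intervalIntegral.integral_congr fun r hr => ?_
    rw [Set.uIcc_of_le t.coe_nonneg] at hr
    simp only [toNNReal_add_coe s hr.1, decay_shift s hr.1 t.coe_nonneg]
  rw [h1]
  have : 0 ≤ ∫ u in (0 : ℝ)..s, decay a x u (s + t) ^ 2 * σ (x u.toNNReal) ^ 2 :=
    intervalIntegral.integral_nonneg s.coe_nonneg fun u _ => by positivity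
  linarith

lemma condVar_congr {x' : ℝ≥0 → Fin N} {t : ℝ≥0} (h : ∀ u ≤ t, x u = x' u) :
    condVar a σ x t = condVar a σ x' t := by
  have hu : ∀ u : ℝ, u ≤ t → x u.toNNReal = x' u.toNNReal := fun u hu =>
    h _ (Real.toNNReal_le_iff_le_coe.2 hu)
  refine intervalIntegral.integral_congr fun u hut => ?_
  rw [Set.uIcc_of_le t.coe_nonneg] at hut
  have hd : decay a x u t = decay a x' u t := by
    rw [decay, decay]
    congr 1
    refine intervalIntegral.integral_congr fun r hr => ?_
    rw [Set.uIcc_of_le hut.2] at hr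
    simp only [hu r hr.2]
  simp only [hu u hut.2, hd]

lemma gridPoint_mono (n : ℕ) : Monotone (gridPoint n) := fun i j hij => by
  unfold gridPoint
  gcongr

lemma gridIndex_mono (n : ℕ) : Monotone (gridIndex n) := fun u v huv => by
  unfold gridIndex
  exact Nat.floor_mono (by gcongr)

lemma measurable_comp_gridAbove (x : ℝ≥0 → Fin N) (n : ℕ) (f : Fin N → ℝ) :
    Measurable fun u => f (x (gridAbove n u)) := by
  have h : Measurable fun k => f (x (gridPoint n k)) := Measurable.of_discrete
  simp only [gridAbove]
  exact h.comp (measurable_gridIndex n)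

/-- Sampled paths agree with `x` eventually at each time. Dominated convergence applies because the
propagator up to time `t` is at most 1. -/
lemma tendsto_condVar_gridAbove (ha : ∀ i, a i ≤ 0) (hc : RightConst x) (t : ℝ≥0) :
    Tendsto (fun n => condVar a σ (fun u => x (gridAbove n u)) t) atTop
      (𝓝 (condVar a σ x t)) := by
  have hpt : ∀ (f : Fin N → ℝ) (u : ℝ),
      Tendsto (fun n => f (x (gridAbove n u.toNNReal))) atTop (𝓝 (f (x u.toNNReal))) :=
    fun f u => tendsto_const_nhds.congr' (by
      filter_upwards [hc.eventually_gridAbove u.toNNReal] with n hn using by rw [hn])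
  have hdec : ∀ u : ℝ, Tendsto (fun n => decay a (fun u => x (gridAbove n u)) u t) atTop
      (𝓝 (decay a x u t)) := fun u => by
    refine (Real.continuous_exp.tendsto _).comp ?_
    refine intervalIntegral.tendsto_integral_filter_of_dominated_convergence (fun _ => ‖a‖)
      (Eventually.of_forall fun n => ?_) (Eventually.of_forall fun n =>
        Eventually.of_forall fun r _ => norm_le_pi_norm a _) intervalIntegrable_const
      (Eventually.of_forall fun r _ => hpt a r)
    exact ((measurable_comp_gridAbove x n a).comp measurable_real_toNNReal).aestronglyMeasurable
  refine intervalIntegral.tendsto_integral_filter_of_dominated_convergence (fun _ => ‖σ‖ ^ 2)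
    (Eventually.of_forall fun n => ?_) (Eventually.of_forall fun n =>
      Eventually.of_forall fun u hu => ?_) intervalIntegrable_const
    (Eventually.of_forall fun u _ => ((hdec u).pow 2).mul ((hpt σ u).pow 2))
  · have h1 := measurable_comp_gridAbove x n
    exact (((continuous_decay h1 t).measurable.pow_const 2).mul
      ((measurable_path h1 σ).pow_const 2)).aestronglyMeasurable
  · rw [Set.uIoc_of_le t.coe_nonneg] at hu
    rw [norm_mul, norm_pow, norm_pow, Real.norm_eq_abs, abs_of_pos (decay_pos _ _)]
    have h1 : decay a (fun u => x (gridAbove n u)) u t ^ 2 ≤ 1 :=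
      pow_le_one₀ (decay_pos _ _).le (decay_le_one ha hu.2)
    have h2 : ‖σ (x (gridAbove n u.toNNReal))‖ ^ 2 ≤ ‖σ‖ ^ 2 := by
      gcongr; exact norm_le_pi_norm σ _
    nlinarith [sq_nonneg ‖σ (x (gridAbove n u.toNNReal))‖]

variable {Ω : Type*} [MeasurableSpace Ω]

lemma measurable_intervalIntegral {F : ℝ × Ω → ℝ} (hF : Measurable F) (s t : ℝ) :
    Measurable fun ω => ∫ u in s..t, F (u, ω) := by
  simp only [intervalIntegral]
  have h : ∀ A : Set ℝ, Measurable fun ω => ∫ u in A, F (u, ω) := fun A =>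
    (StronglyMeasurable.integral_prod_left' (μ := volume.restrict A)
      hF.stronglyMeasurable).measurable
  exact (h _).sub (h _)

variable {X : ℝ≥0 → Ω → Fin N}

lemma measurable_uncurry_toNNReal (hX : ∀ t, Measurable (X t))
    (hc : ∀ ω, RightConst fun t => X t ω) (f : Fin N → ℝ) :
    Measurable fun p : ℝ × Ω => f (X p.1.toNNReal p.2) :=
  (measurable_uncurry_of_rightConst hX hc f).comp
    (measurable_real_toNNReal.prodMap measurable_id)

lemma measurable_decay (hX : ∀ t, Measurable (X t)) (hc : ∀ ω, RightConst fun t => X t ω)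
    (s t : ℝ) : Measurable fun ω => decay a (fun r => X r ω) s t :=
  (measurable_intervalIntegral (measurable_uncurry_toNNReal hX hc a) s t).exp

lemma measurable_condVar (hX : ∀ t, Measurable (X t)) (hc : ∀ ω, RightConst fun t => X t ω)
    (t : ℝ) : Measurable fun ω => condVar a σ (fun r => X r ω) t := by
  have hd : Measurable fun p : ℝ × Ω => decay a (fun r => X r p.2) p.1 t := by
    -- Carathéodory argument: continuous in the starting time, measurable in `ω`.
    refine measurable_uncurry_of_continuous_of_measurable
      (u := fun u ω => decay a (fun r => X r ω) u t) (fun ω => ?_) fun u => ?_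
    · exact continuous_decay (hc ω).measurable_comp t
    · exact measurable_decay hX hc u t
  exact measurable_intervalIntegral
    ((hd.pow_const 2).mul ((measurable_uncurry_toNNReal hX hc σ).pow_const 2)) 0 t

end PathFunctionals

/-! ### Consequences of stationarity -/

section Stationary

variable {N : ℕ} {lam : Fin N → ℝ} {q : Matrix (Fin N) (Fin N) ℝ} {mu : Fin N → ℝ}
  {a σ : Fin N → ℝ} {Ω : Type*} [MeasurableSpace Ω] {Q : Measure Ω} [IsProbabilityMeasure Q]
  {X : ℝ≥0 → Ω → Fin N}

/-- The law of the conditional variance is invariant under time shifts. -/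
lemma integral_condVar_shift (hmu : IsInvariantProbability lam q mu)
    (hX : IsMarkovJumpProcess lam q mu Q X) (hc : ∀ ω, RightConst fun t => X t ω)
    (ha : ∀ i, a i ≤ 0) {F : ℝ → ℝ} (hF : Continuous F) (hF1 : ∀ v, 0 ≤ v → |F v| ≤ 1)
    (s t : ℝ≥0) :
    ∫ ω, F (condVar a σ (fun r => X (s + r) ω) t) ∂Q =
      ∫ ω, F (condVar a σ (fun r => X r ω) t) ∂Q := by
  -- The discretized functional depends on finitely many samples. The `min` only makes the index
  -- legal beyond `t` and is inactive on [0, t], where `condVar` looks.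
  set g : (n : ℕ) → (Fin (gridIndex n t + 1) → Fin N) → ℝ := fun n i =>
    F (condVar a σ (fun u => i ⟨min (gridIndex n u) (gridIndex n t), by omega⟩) t) with hg
  have hsample : ∀ (n : ℕ) (s : ℝ≥0) (ω : Ω),
      F (condVar a σ (fun u => X (s + gridAbove n u) ω) t) =
        g n (fun k => X (s + gridPoint n k) ω) := fun n s ω => by
    simp only [hg]
    congr 1
    refine condVar_congr fun u hu => ?_
    simp only [gridAbove, min_eq_left (gridIndex_mono n hu)]
  have hlim : ∀ s : ℝ≥0, Tendsto (fun n => ∫ ω, g n (fun k => X (s + gridPoint n k) ω) ∂Q) atTop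
      (𝓝 (∫ ω, F (condVar a σ (fun r => X (s + r) ω) t) ∂Q)) := fun s => by
    refine tendsto_integral_of_dominated_convergence (fun _ => 1) (fun n => ?_)
      (integrable_const 1) (fun n => ?_) (Eventually.of_forall fun ω => ?_)
    · have h1 : Measurable fun ω => fun k : Fin (gridIndex n t + 1) => X (s + gridPoint n k) ω :=
        measurable_pi_lambda _ fun k => hX.measurable _
      exact ((Measurable.of_discrete (f := g n)).comp h1).aestronglyMeasurable
    · exact Eventually.of_forall fun ω => hF1 _ (condVar_nonneg t)
    · simp only [← hsample]
      exact (hF.tendsto _).comp (tendsto_condVar_gridAbove ha ((hc ω).shift s) t)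
  have h0 := hlim 0
  simp only [zero_add] at h0
  refine tendsto_nhds_unique (hlim s) (h0.congr fun n => ?_)
  exact (integral_sample_shift hmu hX _ (gridPoint_mono n) (g n) s).symm

/-- The Laplace transform of the conditional variance is nonincreasing in time. -/
lemma antitone_integral_exp_condVar (hmu : IsInvariantProbability lam q mu)
    (hX : IsMarkovJumpProcess lam q mu Q X) (hc : ∀ ω, RightConst fun t => X t ω)
    (ha : ∀ i, a i ≤ 0) {c : ℝ} (hc0 : 0 ≤ c) :
    Antitone fun t : ℝ≥0 => ∫ ω, Real.exp (-(c * condVar a σ (fun r => X r ω) t)) ∂Q := by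
  intro t t' htt
  obtain ⟨s, rfl⟩ := exists_add_of_le htt
  have hinteg : ∀ (s t : ℝ≥0), Integrable
      (fun ω => Real.exp (-(c * condVar a σ (fun r => X (s + r) ω) t))) Q := fun s t => by
    refine Integrable.of_bound (C := 1) ?_ (Eventually.of_forall fun ω => ?_)
    · exact ((measurable_condVar (fun r => hX.measurable (s + r))
        (fun ω => (hc ω).shift s) t).const_mul c).neg.exp.aestronglyMeasurable
    · rw [Real.norm_eq_abs, Real.abs_exp, Real.exp_le_one_iff]
      exact neg_nonpos.2 (mul_nonneg hc0 (condVar_nonneg t))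
  have h0 := hinteg 0 (t + s)
  simp only [zero_add] at h0
  dsimp only
  rw [← integral_condVar_shift hmu hX hc ha (F := fun v => Real.exp (-(c * v)))
    (by fun_prop) (fun v hv => by
      rw [Real.abs_exp, Real.exp_le_one_iff]; exact neg_nonpos.2 (mul_nonneg hc0 hv)) s t]
  refine integral_mono h0 (hinteg s t) fun ω => ?_
  rw [Real.exp_le_exp, neg_le_neg_iff]
  refine mul_le_mul_of_nonneg_left ?_ hc0
  have := condVar_shift_le (a := a) (σ := σ) (hc ω).measurable_comp s t
  rwa [add_comm t s, NNReal.coe_add]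

/-- Jensen's inequality bounds a power of the propagator over `n` units of time by the mean of
products along unit-spaced samples. -/
lemma decay_pow_le (x : ℝ≥0 → Fin N) (hx : ∀ f : Fin N → ℝ, Measurable fun u => f (x u))
    (κ : ℕ) (s : ℝ≥0) (n : ℕ) :
    decay a x s (s + n) ^ κ ≤
      ∫ r in (0 : ℝ)..1, ∏ k : Fin n, Real.exp (κ * a (x (s + r.toNNReal + (k : ℕ)))) := by
  have hmk : ∀ k : ℕ, Measurable fun r : ℝ => a (x (s + r.toNNReal + k)) := fun k =>
    (hx a).comp ((measurable_real_toNNReal.const_add s).add_const (k : ℝ≥0))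
  have hik : ∀ k : ℕ, IntervalIntegrable (fun r : ℝ => a (x (s + r.toNNReal + k)))
      volume 0 1 := fun k =>
    (hmk k).intervalIntegrable_of_bound (C := ‖a‖) (fun _ => norm_le_pi_norm a _) 0 1
  -- Each unit slice is parametrized by the same offset `r` in [0, 1].
  have hsum : ∫ u in (s : ℝ)..(s + n), a (x u.toNNReal) =
      ∫ r in (0 : ℝ)..1, ∑ k ∈ Finset.range n, a (x (s + r.toNNReal + k)) := by
    rw [intervalIntegral.integral_finsetSum fun k _ => hik k]
    have h := intervalIntegral.sum_integral_adjacent_intervals (a := fun k : ℕ => (s : ℝ) + k)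
      (n := n) (μ := volume) (fun k _ => intervalIntegrable_path hx a (s + k) (s + (k + 1 : ℕ)))
    simp only [Nat.cast_zero, add_zero] at h
    rw [← h]
    refine Finset.sum_congr rfl fun k _ => ?_
    have h2 := intervalIntegral.integral_comp_add_left (a := 0) (b := 1)
      (fun u : ℝ => a (x u.toNNReal)) ((s : ℝ) + k)
    rw [add_zero] at h2
    push_cast
    rw [← add_assoc, ← h2]
    refine intervalIntegral.integral_congr fun r hr => ?_
    rw [Set.uIcc_of_le zero_le_one] at hr
    have e := toNNReal_add_coe (s + k) hr.1
    push_cast at e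
    simp only [e]
    congr 2
    abel
  rw [decay, ← Real.exp_nat_mul, hsum, ← intervalIntegral.integral_const_mul]
  simp only [← Real.exp_sum, ← Finset.mul_sum]
  simp only [Finset.sum_range]
  rw [intervalIntegral.integral_of_le zero_le_one, intervalIntegral.integral_of_le zero_le_one]
  have : IsProbabilityMeasure (volume.restrict (Set.Ioc (0 : ℝ) 1)) := ⟨by simp⟩
  have hmeas : Measurable fun r : ℝ =>
      (κ : ℝ) * ∑ k : Fin n, a (x (s + r.toNNReal + (k : ℕ))) :=
    (Finset.measurable_fun_sum _ fun (k : Fin n) _ => hmk k).const_mul _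
  have hbd : ∀ r : ℝ, ‖(κ : ℝ) * ∑ k : Fin n, a (x (s + r.toNNReal + (k : ℕ)))‖ ≤
      κ * (n * ‖a‖) := fun r => by
    rw [norm_mul, Real.norm_natCast]
    gcongr
    refine (norm_sum_le _ _).trans ((Finset.sum_le_sum fun k _ => norm_le_pi_norm a _).trans ?_)
    simp
  refine convexOn_exp.map_integral_le Real.continuous_exp.continuousOn isClosed_univ
    (by simp) (Integrable.of_bound hmeas.aestronglyMeasurable _ (Eventually.of_forall hbd))
    (Integrable.of_bound (C := Real.exp (κ * (n * ‖a‖))) hmeas.exp.aestronglyMeasurable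
      (Eventually.of_forall fun r => ?_))
  rw [Function.comp, Real.norm_eq_abs, Real.abs_exp, Real.exp_le_exp]
  exact (le_abs_self _).trans (hbd r)

/-- Exponential decay of the moments of the propagator. -/
lemma exists_integral_decay_pow_le (hlam : ∀ i, 0 < lam i)
    (hq : q ∈ Matrix.rowStochastic ℝ (Fin N)) (hirr : q.IsIrreducible)
    (hmu : IsInvariantProbability lam q mu) (hX : IsMarkovJumpProcess lam q mu Q X)
    (hc : ∀ ω, RightConst fun t => X t ω) (ha : ∀ i, a i ≤ 0) {l : Fin N} (hl : a l < 0)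
    {κ : ℕ} (hκ : κ ≠ 0) :
    ∃ ρ : ℝ, 0 < ρ ∧ ρ < 1 ∧ ∀ (s : ℝ≥0) (n : ℕ),
      ∫ ω, decay a (fun r => X r ω) s (s + n) ^ κ ∂Q ≤ ρ ^ (n - 1) := by
  have hκ' : (0 : ℝ) < κ := by exact_mod_cast Nat.pos_of_ne_zero hκ
  set f : Fin N → ℝ := fun i => Real.exp (κ * a i) with hf
  have hf0 : ∀ i, 0 ≤ f i := fun i => Real.exp_nonneg _
  have hf1 : ∀ i, f i ≤ 1 := fun i => Real.exp_le_one_iff.2 (by nlinarith [ha i])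
  have hfl : f l < 1 := Real.exp_lt_one_iff.2 (by nlinarith)
  obtain ⟨ρ, hρ0, hρ1, hρ⟩ := exists_transition_mul_le hlam hq hirr hf0 hf1 hfl
  refine ⟨ρ, hρ0, hρ1, fun s n => ?_⟩
  -- `n` samples give `n - 1` transitions. For `n = 0` the propagator is 1 and the truncated
  -- exponent is 0.
  cases n with
  | zero => simp
  | succ n =>
    set G : Ω → ℝ → ℝ := fun ω r => ∏ k : Fin (n + 1), f (X (s + r.toNNReal + (k : ℕ)) ω) with hG
    have hGm : Measurable (Function.uncurry G) := by
      refine Finset.measurable_fun_prod _ fun k _ => ?_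
      have h1 := measurable_uncurry_of_rightConst hX.measurable hc f
      refine h1.comp (Measurable.prodMk ?_ measurable_fst)
      exact ((measurable_real_toNNReal.comp measurable_snd).const_add s).add_const _
    have hG0 : ∀ ω r, 0 ≤ G ω r := fun ω r => Finset.prod_nonneg fun k _ => hf0 _
    have hG1 : ∀ ω r, G ω r ≤ 1 := fun ω r =>
      Finset.prod_le_one (fun k _ => hf0 _) fun k _ => hf1 _
    have hμ : IsProbabilityMeasure (volume.restrict (Set.Ioc (0 : ℝ) 1)) := ⟨by simp⟩
    have hGi : Integrable (Function.uncurry G) (Q.prod (volume.restrict (Set.Ioc (0 : ℝ) 1))) :=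
      Integrable.of_bound (C := 1) hGm.aestronglyMeasurable (Eventually.of_forall fun p => by
        rw [Real.norm_eq_abs, Function.uncurry, abs_of_nonneg (hG0 _ _)]; exact hG1 _ _)
    have hdi : Integrable (fun ω => decay a (fun r => X r ω) s (s + (n + 1 : ℕ)) ^ κ) Q := by
      refine Integrable.of_bound (C := 1)
        ((measurable_decay hX.measurable hc _ _).pow_const κ).aestronglyMeasurable
        (Eventually.of_forall fun ω => ?_)
      rw [Real.norm_eq_abs, abs_of_nonneg (pow_nonneg (decay_pos _ _).le _)]
      exact pow_le_one₀ (decay_pos _ _).le (decay_le_one ha (by simp; positivity))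
    calc ∫ ω, decay a (fun r => X r ω) s (s + (n + 1 : ℕ)) ^ κ ∂Q
        ≤ ∫ ω, (∫ r in Set.Ioc (0 : ℝ) 1, G ω r) ∂Q := by
          refine integral_mono hdi hGi.integral_prod_left fun ω => ?_
          have := decay_pow_le (a := a) (fun r => X r ω) (hc ω).measurable_comp κ s (n + 1)
          rwa [intervalIntegral.integral_of_le zero_le_one] at this
      _ = ∫ r in Set.Ioc (0 : ℝ) 1, ∫ ω, G ω r ∂Q := integral_integral_swap hGi
      _ ≤ ∫ r in Set.Ioc (0 : ℝ) 1, ρ ^ n := by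
          refine integral_mono hGi.integral_prod_right (integrable_const _) fun r => ?_
          -- After Fubini the offset `r` is fixed, so what remains is a chain sampled at unit
          -- spacing.
          have h1 := integral_sample hmu hX n (t := fun k => s + r.toNNReal + k)
            (fun i j hij => add_le_add le_rfl (Nat.cast_le.2 hij)) (fun i => ∏ k, f (i k))
          simp only [hG]
          rw [h1]
          refine sum_pathWeight_mul_prod_le hlam hq hmu hf0 hf1 hρ (fun k => ?_) n
          push_cast
          rw [← add_assoc, add_tsub_cancel_left]
      _ = ρ ^ (n + 1 - 1) := by simp

end Stationary

/-! ### Moments of the conditional variance -/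

section Moments

/-- Translates moments into L^p norms, where Minkowski's inequality is available. -/
lemma eLpNorm_pow_eq_lintegral_ofReal_pow {α : Type*} {m : MeasurableSpace α} {μ : Measure α}
    {g : α → ℝ} (hg : ∀ x, 0 ≤ g x) {p : ℕ} (hp : p ≠ 0) :
    eLpNorm g ((p : ℝ≥0) : ℝ≥0∞) μ ^ p = ∫⁻ x, ENNReal.ofReal (g x ^ p) ∂μ := by
  have h := eLpNorm_nnreal_pow_eq_lintegral (f := g) (μ := μ) (p := (p : ℝ≥0))
    (by exact_mod_cast hp)
  simp only [NNReal.coe_natCast, ENNReal.rpow_natCast] at h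
  rw [h]
  refine lintegral_congr fun x => ?_
  rw [Real.enorm_of_nonneg (hg x), ENNReal.ofReal_pow (hg x)]

variable {N : ℕ} {lam : Fin N → ℝ} {q : Matrix (Fin N) (Fin N) ℝ} {mu : Fin N → ℝ}
  {a σ : Fin N → ℝ}

lemma decay_antitone_left {x : ℝ≥0 → Fin N} (hx : ∀ f : Fin N → ℝ, Measurable fun u => f (x u))
    (ha : ∀ i, a i ≤ 0) {r s : ℝ} (hrs : r ≤ s) (t : ℝ) : decay a x r t ≤ decay a x s t := by
  rw [← decay_mul hx r s t]
  exact mul_le_of_le_one_left (decay_pos _ _).le (decay_le_one ha hrs)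

/-- Since a ≤ 0, on each unit interval the propagator is largest when started from the right
endpoint. -/
lemma condVar_natCast_le {x : ℝ≥0 → Fin N} (hx : ∀ f : Fin N → ℝ, Measurable fun u => f (x u))
    (ha : ∀ i, a i ≤ 0) (n : ℕ) :
    condVar a σ x n ≤ ‖σ‖ ^ 2 * ∑ k ∈ Finset.range n, decay a x (k + 1 : ℕ) n ^ 2 := by
  have hi := intervalIntegrable_condVar (a := a) (σ := σ) hx
  have h := intervalIntegral.sum_integral_adjacent_intervals (a := fun k : ℕ => (k : ℝ))
    (n := n) (μ := volume) (fun k _ => hi k (k + 1 : ℕ) n)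
  rw [Nat.cast_zero] at h
  rw [condVar, ← h, Finset.mul_sum]
  refine Finset.sum_le_sum fun k _ => ?_
  have hk : (k : ℝ) ≤ (k + 1 : ℕ) := by push_cast; linarith
  have hmono := intervalIntegral.integral_mono_on hk (hi k (k + 1 : ℕ) n)
    (intervalIntegrable_const (c := ‖σ‖ ^ 2 * decay a x (k + 1 : ℕ) n ^ 2)) fun u hu => by
      rw [mul_comm]
      have h1 : σ (x u.toNNReal) ^ 2 ≤ ‖σ‖ ^ 2 := by
        rw [← sq_abs]
        gcongr
        exact norm_le_pi_norm σ _
      have h2 : decay a x u n ^ 2 ≤ decay a x (k + 1 : ℕ) n ^ 2 :=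
        pow_le_pow_left₀ (decay_pos _ _).le (decay_antitone_left hx ha hu.2 n) 2
      exact mul_le_mul h1 h2 (sq_nonneg _) (sq_nonneg _)
  refine hmono.trans (le_of_eq ?_)
  rw [intervalIntegral.integral_const]
  push_cast
  simp

variable {Ω : Type*} [MeasurableSpace Ω] {Q : Measure Ω} [IsProbabilityMeasure Q]
  {X : ℝ≥0 → Ω → Fin N}

/-- All moments of the conditional variance are bounded in time. -/
lemma exists_lintegral_condVar_pow_le (hlam : ∀ i, 0 < lam i)
    (hq : q ∈ Matrix.rowStochastic ℝ (Fin N)) (hirr : q.IsIrreducible)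
    (hmu : IsInvariantProbability lam q mu) (hX : IsMarkovJumpProcess lam q mu Q X)
    (hc : ∀ ω, RightConst fun t => X t ω) (ha : ∀ i, a i ≤ 0) {l : Fin N} (hl : a l < 0)
    {p : ℕ} (hp : p ≠ 0) :
    ∃ C : ℝ≥0∞, C ≠ ∞ ∧ ∀ n : ℕ,
      ∫⁻ ω, ENNReal.ofReal (condVar a σ (fun r => X r ω) n ^ p) ∂Q ≤ C := by
  obtain ⟨ρ, hρ0, hρ1, hρ⟩ := exists_integral_decay_pow_le (a := a) hlam hq hirr hmu hX hc ha hl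
    (κ := 2 * p) (by omega)
  -- Moments of order `2 * p` of the propagator are L^p norms of its square to the power `p`, so the
  -- geometric ratio becomes the `p`-th root of `ρ`.
  set b : ℝ≥0∞ := ENNReal.ofReal ρ ^ ((p : ℝ)⁻¹) with hb
  have hp' : (0 : ℝ) < p := by exact_mod_cast Nat.pos_of_ne_zero hp
  have hb1 : b < 1 := ENNReal.rpow_lt_one (by simpa using hρ1) (by positivity)
  have hdm : ∀ s t : ℝ, Measurable fun ω => decay a (fun r => X r ω) s t :=
    measurable_decay hX.measurable hc
  have hterm : ∀ n k : ℕ, k < n →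
      eLpNorm (fun ω => decay a (fun r => X r ω) (k + 1 : ℕ) n ^ 2) ((p : ℝ≥0) : ℝ≥0∞) Q ≤
        b ^ (n - 1 - k - 1) := by
    intro n k hk
    refine (ENNReal.pow_right_strictMono hp).le_iff_le.1 ?_
    rw [eLpNorm_pow_eq_lintegral_ofReal_pow (fun ω => sq_nonneg _) hp]
    have hbp : b ^ p = ENNReal.ofReal ρ := by
      rw [hb, ← ENNReal.rpow_natCast, ← ENNReal.rpow_mul, inv_mul_cancel₀ hp'.ne',
        ENNReal.rpow_one]
    rw [← pow_mul, mul_comm, pow_mul, hbp, ← ENNReal.ofReal_pow hρ0.le]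
    simp only [← pow_mul]
    have hn : ((n : ℕ) : ℝ) = ((k + 1 : ℕ) : ℝ≥0) + ((n - 1 - k : ℕ) : ℝ) := by
      have : n = (k + 1) + (n - 1 - k) := by omega
      have h2 : ((n : ℕ) : ℝ) = ((k + 1 + (n - 1 - k) : ℕ) : ℝ) := congrArg _ this
      rw [h2]; push_cast; ring
    have hmain := hρ (k + 1 : ℕ) (n - 1 - k)
    rw [← hn, NNReal.coe_natCast] at hmain
    rw [← ofReal_integral_eq_lintegral_ofReal]
    · exact ENNReal.ofReal_le_ofReal hmain
    · refine Integrable.of_bound (C := 1) ((hdm _ _).pow_const _).aestronglyMeasurable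
        (Eventually.of_forall fun ω => ?_)
      rw [Real.norm_eq_abs, abs_of_nonneg (pow_nonneg (decay_pos _ _).le _)]
      exact pow_le_one₀ (decay_pos _ _).le (decay_le_one ha (by exact_mod_cast hk))
    · exact Eventually.of_forall fun ω => pow_nonneg (decay_pos _ _).le _
  -- The truncated exponent repeats the term 1; splitting off `j = 0` leaves a geometric series.
  have hgeom : ∑' j : ℕ, b ^ (j - 1) ≠ ∞ := by
    rw [tsum_eq_zero_add' ENNReal.summable]
    simp only [zero_tsub, pow_zero, add_tsub_cancel_right, ENNReal.tsum_geometric]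
    have : 1 - b ≠ 0 := (tsub_pos_of_lt hb1).ne'
    simp [this]
  refine ⟨(‖‖σ‖ ^ 2‖ₑ * ∑' j : ℕ, b ^ (j - 1)) ^ p,
    ENNReal.pow_ne_top (ENNReal.mul_ne_top enorm_ne_top hgeom), fun n => ?_⟩
  have hV0 : ∀ ω, 0 ≤ condVar a σ (fun r => X r ω) n := fun ω => by
    have := condVar_nonneg (a := a) (σ := σ) (x := fun r => X r ω) (n : ℝ≥0)
    rwa [NNReal.coe_natCast] at this
  rw [← eLpNorm_pow_eq_lintegral_ofReal_pow hV0 hp]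
  refine pow_le_pow_left₀ (zero_le) ?_ p
  calc eLpNorm (fun ω => condVar a σ (fun r => X r ω) n) ((p : ℝ≥0) : ℝ≥0∞) Q
      ≤ eLpNorm (‖σ‖ ^ 2 • ∑ k ∈ Finset.range n,
          fun ω => decay a (fun r => X r ω) (k + 1 : ℕ) n ^ 2) ((p : ℝ≥0) : ℝ≥0∞) Q := by
        refine eLpNorm_mono_real fun ω => ?_
        rw [Real.norm_eq_abs, abs_of_nonneg (hV0 ω)]
        simpa using condVar_natCast_le (hc ω).measurable_comp ha n
    _ = ‖‖σ‖ ^ 2‖ₑ * eLpNorm (∑ k ∈ Finset.range n,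
          fun ω => decay a (fun r => X r ω) (k + 1 : ℕ) n ^ 2) ((p : ℝ≥0) : ℝ≥0∞) Q :=
        eLpNorm_const_smul _ _ _ _
    _ ≤ ‖‖σ‖ ^ 2‖ₑ * ∑ k ∈ Finset.range n, b ^ (n - 1 - k - 1) := by
        gcongr
        refine (eLpNorm_sum_le (fun k _ => ((hdm _ _).pow_const 2).aestronglyMeasurable) ?_).trans
          (Finset.sum_le_sum fun k hk => hterm n k (Finset.mem_range.1 hk))
        exact_mod_cast Nat.one_le_iff_ne_zero.2 hp
    _ ≤ ‖‖σ‖ ^ 2‖ₑ * ∑' j : ℕ, b ^ (j - 1) := by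
        gcongr
        rw [Finset.sum_range_reflect (fun j => b ^ (j - 1)) n]
        exact ENNReal.sum_le_tsum _

/-- The propagator from time `0` tends to `0` almost surely. -/
lemma ae_tendsto_decay (hlam : ∀ i, 0 < lam i)
    (hq : q ∈ Matrix.rowStochastic ℝ (Fin N)) (hirr : q.IsIrreducible)
    (hmu : IsInvariantProbability lam q mu) (hX : IsMarkovJumpProcess lam q mu Q X)
    (hc : ∀ ω, RightConst fun t => X t ω) (ha : ∀ i, a i ≤ 0) {l : Fin N} (hl : a l < 0) :
    ∀ᵐ ω ∂Q, Tendsto (fun t : ℝ≥0 => decay a (fun r => X r ω) 0 t) atTop (𝓝 0) := by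
  obtain ⟨ρ, hρ0, hρ1, hρ⟩ := exists_integral_decay_pow_le (a := a) hlam hq hirr hmu hX hc ha hl
    (κ := 1) one_ne_zero
  have hdm : ∀ s t : ℝ, Measurable fun ω => decay a (fun r => X r ω) s t :=
    measurable_decay hX.measurable hc
  have hterm : ∀ n : ℕ, ∫⁻ ω, ENNReal.ofReal (decay a (fun r => X r ω) 0 n) ∂Q ≤
      ENNReal.ofReal ρ ^ (n - 1) := fun n => by
    have h := hρ 0 n
    simp only [NNReal.coe_zero, zero_add, pow_one] at h
    rw [← ofReal_integral_eq_lintegral_ofReal, ← ENNReal.ofReal_pow hρ0.le]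
    · exact ENNReal.ofReal_le_ofReal h
    · refine Integrable.of_bound (C := 1) (hdm _ _).aestronglyMeasurable
        (Eventually.of_forall fun ω => ?_)
      rw [Real.norm_eq_abs, abs_of_pos (decay_pos _ _)]
      exact decay_le_one ha (by positivity)
    · exact Eventually.of_forall fun ω => (decay_pos _ _).le
  have hsum : ∫⁻ ω, ∑' n : ℕ, ENNReal.ofReal (decay a (fun r => X r ω) 0 n) ∂Q ≠ ∞ := by
    rw [lintegral_tsum fun n => (hdm _ _).ennreal_ofReal.aemeasurable]
    refine ne_top_of_le_ne_top ?_ (ENNReal.tsum_le_tsum hterm)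
    rw [tsum_eq_zero_add' ENNReal.summable]
    simp only [zero_tsub, pow_zero, add_tsub_cancel_right, ENNReal.tsum_geometric]
    have : 1 - ENNReal.ofReal ρ ≠ 0 := (tsub_pos_of_lt (by simpa using hρ1)).ne'
    simp [this]
  -- The expectations are summable, so the series is almost surely finite and its terms tend to 0.
  -- Real times follow by monotonicity from their integer parts.
  have hae := ae_lt_top (Measurable.tsum fun n => (hdm 0 (n : ℕ)).ennreal_ofReal) hsum
  filter_upwards [hae] with ω hω
  have h1 := ENNReal.tendsto_atTop_zero_of_tsum_ne_top hω.ne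
  have h2 : Tendsto (fun n : ℕ => decay a (fun r => X r ω) 0 n) atTop (𝓝 0) := by
    have := (ENNReal.tendsto_toReal ENNReal.zero_ne_top).comp h1
    refine this.congr fun n => ?_
    simp [ENNReal.toReal_ofReal (decay_pos _ _).le]
  have h3 : Tendsto (fun t : ℝ≥0 => decay a (fun r => X r ω) 0 (⌊t⌋₊ : ℕ)) atTop (𝓝 0) :=
    h2.comp tendsto_nat_floor_atTop
  refine squeeze_zero (fun t => (decay_pos _ _).le) (fun t => ?_) h3
  have hfl : ((⌊t⌋₊ : ℕ) : ℝ) ≤ t := by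
    have := Nat.floor_le (zero_le (a := t))
    exact_mod_cast this
  rw [← decay_mul (hc ω).measurable_comp 0 (⌊t⌋₊ : ℕ) t]
  exact mul_le_of_le_one_right (decay_pos _ _).le (decay_le_one ha hfl)

end Moments

/-! ### Weak convergence from characteristic functions -/

/-- Existence half of Lévy's theorem. Continuity at 0 gives tightness, Prokhorov's theorem gives
compactness, and a limit along an ultrafilter has characteristic function φ without extraction of a
subsequence. -/
lemma exists_charFun_eq_of_tendsto {μ : ℕ → ProbabilityMeasure ℝ} {φ : ℝ → ℂ}
    (hφ : ContinuousAt φ 0)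
    (h : ∀ ξ, Tendsto (fun n => charFun (μ n : Measure ℝ) ξ) atTop (𝓝 (φ ξ))) :
    ∃ ν : ProbabilityMeasure ℝ, ∀ ξ, charFun (ν : Measure ℝ) ξ = φ ξ := by
  have ht : IsTightMeasureSet (Set.range fun n => (μ n : Measure ℝ)) :=
    isTightMeasureSet_of_tendsto_charFun hφ h
  have hK : IsCompact (closure (Set.range μ)) := by
    refine isCompact_closure_of_isTightMeasureSet ?_
    convert ht using 1
    ext m
    simp
  obtain ⟨ν, -, hν⟩ := hK.ultrafilter_le_nhds ((hyperfilter ℕ).map μ)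
    (le_principal_iff.2 (univ_mem' (f := (hyperfilter ℕ : Filter ℕ)) fun n =>
      subset_closure (Set.mem_range_self n)))
  refine ⟨ν, fun ξ => ?_⟩
  have hν' : Tendsto μ (hyperfilter ℕ : Filter ℕ) (𝓝 ν) := hν
  have h1 : Tendsto (fun n => charFun (μ n : Measure ℝ) ξ) (hyperfilter ℕ : Filter ℕ)
      (𝓝 (charFun (ν : Measure ℝ) ξ)) := by
    rw [ProbabilityMeasure.tendsto_iff_forall_integral_rclike_tendsto ℂ] at hν'
    simp_rw [charFun_eq_integral_innerProbChar]
    exact hν' (BoundedContinuousFunction.innerProbChar ξ)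
  exact tendsto_nhds_unique h1 ((h ξ).mono_left Nat.hyperfilter_le_atTop)

lemma lintegral_abs_pow_gaussianReal (p : ℕ) (v : ℝ≥0) :
    ∫⁻ r, ENNReal.ofReal (|r| ^ (2 * p)) ∂(gaussianReal 0 v) =
      ENNReal.ofReal ((v : ℝ) ^ p) * ∫⁻ r, ENNReal.ofReal (|r| ^ (2 * p)) ∂(gaussianReal 0 1) := by
  have hv : gaussianReal 0 v = (gaussianReal 0 1).map fun r => √(v : ℝ) * r := by
    rw [gaussianReal_map_const_mul]
    congr 1
    · simp
    · ext; simp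
  rw [hv, lintegral_map (by fun_prop) (by fun_prop), ← lintegral_const_mul _ (by fun_prop)]
  refine lintegral_congr fun r => ?_
  rw [← ENNReal.ofReal_mul (by positivity), abs_mul, mul_pow, pow_mul |√(v : ℝ)|, sq_abs,
    Real.sq_sqrt v.coe_nonneg]

lemma lintegral_abs_pow_gaussianReal_ne_top (n : ℕ) (v : ℝ≥0) :
    ∫⁻ r, ENNReal.ofReal (|r| ^ n) ∂(gaussianReal 0 v) ≠ ∞ := by
  rcases eq_or_ne n 0 with rfl | hn
  · simp
  have h := (memLp_id_gaussianReal (μ := 0) (v := v) (n : ℝ≥0)).eLpNorm_ne_top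
  have h2 := eLpNorm_pow_eq_lintegral_ofReal_pow (μ := gaussianReal 0 v)
    (g := fun r => |r|) (fun r => abs_nonneg r) hn
  rw [← h2]
  refine ENNReal.pow_ne_top ?_
  have e : eLpNorm (fun r : ℝ => |r|) ((n : ℝ≥0) : ℝ≥0∞) (gaussianReal 0 v) =
      eLpNorm id ((n : ℝ≥0) : ℝ≥0∞) (gaussianReal 0 v) :=
    eLpNorm_congr_norm_ae (Eventually.of_forall fun r => by simp)
  rwa [e]

/-- Fatou's inequality for weak convergence, from the portmanteau bound on open sets; `f` may be
unbounded. -/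
lemma lintegral_le_of_tendsto {μ : ℕ → ProbabilityMeasure ℝ} {ν : ProbabilityMeasure ℝ}
    (h : Tendsto μ atTop (𝓝 ν)) {f : ℝ → ℝ} (hf : Continuous f) (hf0 : 0 ≤ f) {C : ℝ≥0∞}
    (hC : ∀ n, ∫⁻ r, ENNReal.ofReal (f r) ∂(μ n : Measure ℝ) ≤ C) :
    ∫⁻ r, ENNReal.ofReal (f r) ∂(ν : Measure ℝ) ≤ C := by
  refine (lintegral_le_liminf_lintegral_of_forall_isOpen_measure_le_liminf_measure hf hf0
    (μs := fun n => (μ n : Measure ℝ)) fun G hG => ?_).trans ?_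
  · exact ProbabilityMeasure.le_liminf_measure_open_of_tendsto h hG
  · exact liminf_le_of_le (h := fun b hb => by
      obtain ⟨n, hn⟩ := hb.exists
      exact hn.trans (hC n))

lemma tendstoInMeasure_of_ae_tendsto {α : Type*} {m : MeasurableSpace α} {μ : Measure α}
    [IsFiniteMeasure μ] {f : ℝ≥0 → α → ℝ} (hf : ∀ t, AEMeasurable (f t) μ) {g : α → ℝ}
    (h : ∀ᵐ x ∂μ, Tendsto (fun t => f t x) atTop (𝓝 (g x))) :
    TendstoInMeasure μ f atTop g := by
  intro ε hε
  refine tendsto_of_seq_tendsto fun u hu => ?_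
  exact tendstoInMeasure_of_tendsto_ae (f := fun n => f (u n))
    (fun n => (hf (u n)).aestronglyMeasurable)
    (h.mono fun x hx => hx.comp hu) ε hε

/-! ### The solution -/

section Solution

variable {N : ℕ} {lam : Fin N → ℝ} {q : Matrix (Fin N) (Fin N) ℝ} {mu : Fin N → ℝ}
  {a σ : Fin N → ℝ} {Ω : Type*} [MeasurableSpace Ω] {Q : Measure Ω}
  {X : ℝ≥0 → Ω → Fin N} {Θ : Type*} {mΘ : MeasurableSpace Θ} {Q' : Measure Θ}
  {F : Filtration ℝ≥0 mΘ} {W : ℝ≥0 → Θ → ℝ}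
  {Y : ℝ≥0 → Ω × Θ → ℝ}

/-- The process may be modified on a null set so that all its paths are step functions. -/
lemma exists_step_modification [Nonempty (Fin N)] (hX : IsMarkovJumpProcess lam q mu Q X) :
    ∃ X' : ℝ≥0 → Ω → Fin N, IsMarkovJumpProcess lam q mu Q X' ∧
      (∀ ω t, ∃ n τ, IsSubdivision (fun u => X' u ω) t n τ) ∧
      ∀ᵐ ω ∂Q, ∀ t, X t ω = X' t ω := by
  classical
  -- Off a measurable set of full measure the path is replaced by a constant one, which preserves
  -- measurability and the finite-dimensional laws.
  obtain ⟨S, hQS, hSm, hS⟩ := hX.step_path.exists_measurable_mem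
  obtain ⟨i₀⟩ := ‹Nonempty (Fin N)›
  set X' : ℝ≥0 → Ω → Fin N := fun t ω => if ω ∈ S then X t ω else i₀ with hX'
  have hae : ∀ᵐ ω ∂Q, ∀ t, X t ω = X' t ω := by
    filter_upwards [hQS] with ω hω t
    simp [hX', hω]
  have hstep : ∀ ω t, ∃ n τ, IsSubdivision (fun u => X' u ω) t n τ := by
    intro ω t
    by_cases hω : ω ∈ S
    · simpa [hX', hω] using hS ω hω t
    · refine ⟨1, fun k => if k = 0 then 0 else t, rfl, rfl, fun i j hij => ?_, fun k _ u _ _ => ?_⟩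
      · split_ifs with h1 h2
        · exact le_rfl
        · exact zero_le
        · omega
        · exact le_rfl
      · simp [hX', hω]
  refine ⟨X', ⟨fun t => ?_, Eventually.of_forall hstep, fun n t i h0 ht => ?_⟩, hstep, hae⟩
  · exact Measurable.ite hSm (hX.measurable t) measurable_const
  · rw [← hX.law n t i h0 ht]
    refine measureReal_congr (eventuallyEq_set.2 ?_)
    filter_upwards [hae] with ω hω
    simp only [hω]

/-- The solution without the contribution of its initial value. -/
def centered (a : Fin N → ℝ) (X : ℝ≥0 → Ω → Fin N) (Y : ℝ≥0 → Ω × Θ → ℝ) (t : ℝ≥0)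
    (p : Ω × Θ) : ℝ :=
  Y t p - decay a (fun r => X r p.1) 0 t * Y 0 p

lemma aemeasurable_centered (hX : ∀ t, Measurable (X t)) (hc : ∀ ω, RightConst fun t => X t ω)
    (hY : IsSwitchingDiffusion a σ Q X Q' F W Y) (t : ℝ≥0) :
    AEMeasurable (centered a X Y t) (Q.prod Q') :=
  (hY.aemeasurable t).sub
    (((measurable_decay hX hc 0 t).comp measurable_fst).aemeasurable.mul (hY.aemeasurable 0))

lemma IsSwitchingDiffusion.congr_path {X' : ℝ≥0 → Ω → Fin N}
    (h : ∀ᵐ ω ∂Q, ∀ t, X t ω = X' t ω) (hY : IsSwitchingDiffusion a σ Q X Q' F W Y) :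
    IsSwitchingDiffusion a σ Q X' Q' F W Y where
  aemeasurable := hY.aemeasurable
  initial := hY.initial
  continuous := hY.continuous
  sde := by
    filter_upwards [hY.sde, Measure.quasiMeasurePreserving_fst (μ := Q) (ν := Q') |>.ae h]
      with p hp hpe
    simpa only [hpe] using hp

variable [IsProbabilityMeasure Q']

/-- Given the path of the jump process, `centered` is Gaussian. -/
lemma ae_hasLaw_centered (hstep : ∀ ω t, ∃ n τ, IsSubdivision (fun u => X u ω) t n τ)
    (hW : IsFiltrationBrownian Q' F W) (hY : IsSwitchingDiffusion a σ Q X Q' F W Y) (t : ℝ≥0) :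
    ∀ᵐ ω ∂Q, HasLaw (fun θ => centered a X Y t (ω, θ))
      (gaussianReal 0 (condVar a σ (fun r => X r ω) t).toNNReal) Q' := by
  filter_upwards [Measure.ae_ae_of_ae_prod hY.continuous, Measure.ae_ae_of_ae_prod hY.sde]
    with ω h1 h2
  exact hasLaw_sub_decay_mul hW.brownian.toIsPreBrownianReal (hstep ω) h1 h2 t

lemma lintegral_centered_pow (hX : ∀ t, Measurable (X t))
    (hstep : ∀ ω t, ∃ n τ, IsSubdivision (fun u => X u ω) t n τ)
    (hW : IsFiltrationBrownian Q' F W) (hY : IsSwitchingDiffusion a σ Q X Q' F W Y) (t : ℝ≥0)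
    (p : ℕ) :
    ∫⁻ r, ENNReal.ofReal (|r| ^ (2 * p)) ∂((Q.prod Q').map (centered a X Y t)) =
      (∫⁻ ω, ENNReal.ofReal (condVar a σ (fun r => X r ω) t ^ p) ∂Q) *
        ∫⁻ r, ENNReal.ofReal (|r| ^ (2 * p)) ∂(gaussianReal 0 1) := by
  have hc : ∀ ω, RightConst fun t => X t ω := fun ω => RightConst.of_subdivision (hstep ω)
  have hm := aemeasurable_centered hX hc hY t
  have hV := measurable_condVar (a := a) (σ := σ) hX hc t
  rw [lintegral_map' (by fun_prop) hm, lintegral_prod _ (by fun_prop),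
    ← lintegral_mul_const _ (by fun_prop)]
  refine lintegral_congr_ae ?_
  filter_upwards [ae_hasLaw_centered hstep hW hY t] with ω hω
  rw [← lintegral_map' (f := fun r => ENNReal.ofReal (|r| ^ (2 * p))) (by fun_prop)
    hω.aemeasurable, hω.map_eq, lintegral_abs_pow_gaussianReal,
    Real.coe_toNNReal _ (condVar_nonneg t)]

variable [IsProbabilityMeasure Q]

lemma charFun_centered (hX : ∀ t, Measurable (X t))
    (hstep : ∀ ω t, ∃ n τ, IsSubdivision (fun u => X u ω) t n τ)
    (hW : IsFiltrationBrownian Q' F W) (hY : IsSwitchingDiffusion a σ Q X Q' F W Y) (t : ℝ≥0)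
    (ξ : ℝ) :
    charFun ((Q.prod Q').map (centered a X Y t)) ξ =
      ((∫ ω, Real.exp (-(ξ ^ 2 / 2 * condVar a σ (fun r => X r ω) t)) ∂Q : ℝ) : ℂ) := by
  have hc : ∀ ω, RightConst fun t => X t ω := fun ω => RightConst.of_subdivision (hstep ω)
  have hm := aemeasurable_centered hX hc hY t
  rw [charFun_apply_real, integral_map hm (Measurable.aestronglyMeasurable (by fun_prop)),
    integral_prod, ← integral_complex_ofReal]
  · refine integral_congr_ae ?_
    filter_upwards [ae_hasLaw_centered hstep hW hY t] with ω hω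
    have h1 := charFun_gaussianReal (μ := 0) (v := (condVar a σ (fun r => X r ω) t).toNNReal) ξ
    rw [← hω.map_eq, charFun_apply_real,
      integral_map hω.aemeasurable (Measurable.aestronglyMeasurable (by fun_prop)),
      Real.coe_toNNReal _ (condVar_nonneg t)] at h1
    rw [h1, Complex.ofReal_exp]
    congr 1
    push_cast
    ring
  · refine Integrable.of_bound (C := 1) ?_ (Eventually.of_forall fun p => ?_)
    · exact AEMeasurable.aestronglyMeasurable (by fun_prop)
    · rw [← Complex.ofReal_mul, Complex.norm_exp_ofReal_mul_I]

/-- The limit law exists and has finite moments when all the paths are step functions. -/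
lemma exists_isLimitLaw_of_step (hlam : ∀ i, 0 < lam i)
    (hq : q ∈ Matrix.rowStochastic ℝ (Fin N)) (hirr : q.IsIrreducible)
    (hmu : IsInvariantProbability lam q mu) (hX : IsMarkovJumpProcess lam q mu Q X)
    (hstep : ∀ ω t, ∃ n τ, IsSubdivision (fun u => X u ω) t n τ)
    (hW : IsFiltrationBrownian Q' F W) (hY : IsSwitchingDiffusion a σ Q X Q' F W Y)
    (ha : ∀ i, a i ≤ 0) {l : Fin N} (hl : a l < 0) :
    ∃ ν : ProbabilityMeasure ℝ, IsLimitLaw a σ Q X Q' F W ν ∧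
      ∀ p : ℕ, p ≠ 0 → ∫⁻ r, ENNReal.ofReal (|r| ^ (2 * p)) ∂(ν : Measure ℝ) ≠ ∞ := by
  have hc : ∀ ω, RightConst fun t => X t ω := fun ω => RightConst.of_subdivision (hstep ω)
  set L : ℝ → ℝ≥0 → ℝ := fun ξ t =>
    ∫ ω, Real.exp (-(ξ ^ 2 / 2 * condVar a σ (fun r => X r ω) t)) ∂Q with hL
  have hLlim : ∀ ξ, Tendsto (L ξ) atTop (𝓝 (⨅ t, L ξ t)) := fun ξ =>
    tendsto_atTop_ciInf (antitone_integral_exp_condVar hmu hX hc ha (by positivity))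
      ⟨0, by rintro _ ⟨t, rfl⟩; exact integral_nonneg fun ω => Real.exp_nonneg _⟩
  set φ : ℝ → ℂ := fun ξ => ((⨅ t, L ξ t : ℝ) : ℂ) with hφdef
  have hchar : ∀ Y' : ℝ≥0 → Ω × Θ → ℝ, IsSwitchingDiffusion a σ Q X Q' F W Y' → ∀ ξ,
      Tendsto (fun t => charFun ((Q.prod Q').map (centered a X Y' t)) ξ) atTop (𝓝 (φ ξ)) :=
    fun Y' hY' ξ => by
      simp only [charFun_centered hX.measurable hstep hW hY']
      exact (Complex.continuous_ofReal.tendsto _).comp (hLlim ξ)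
  have hcast : Tendsto (fun n : ℕ => (n : ℝ≥0)) atTop atTop := tendsto_natCast_atTop_atTop
  -- continuity at the origin of the limit of the characteristic functions
  have hφ : ContinuousAt φ 0 := by
    obtain ⟨C, hCtop, hC⟩ := exists_lintegral_condVar_pow_le (a := a) (σ := σ) hlam hq hirr hmu hX
      hc ha hl (p := 1) one_ne_zero
    have hle : ∀ ξ (n : ℕ), 1 - ξ ^ 2 / 2 * C.toReal ≤ L ξ n := fun ξ n => by
      have hVm := measurable_condVar (a := a) (σ := σ) hX.measurable hc (n : ℝ)
      have hV0 : ∀ ω, 0 ≤ condVar a σ (fun r => X r ω) n := fun ω => by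
        have := condVar_nonneg (a := a) (σ := σ) (x := fun r => X r ω) (n : ℝ≥0)
        rwa [NNReal.coe_natCast] at this
      have hCn := hC n
      simp only [pow_one] at hCn
      have hVi : Integrable (fun ω => condVar a σ (fun r => X r ω) n) Q := by
        refine ⟨hVm.aestronglyMeasurable, ?_⟩
        rw [hasFiniteIntegral_iff_ofReal (Eventually.of_forall hV0)]
        exact hCn.trans_lt (lt_top_iff_ne_top.2 hCtop)
      have hEV : ∫ ω, condVar a σ (fun r => X r ω) n ∂Q ≤ C.toReal := by
        rw [integral_eq_lintegral_of_nonneg_ae (Eventually.of_forall hV0)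
          hVm.aestronglyMeasurable]
        exact ENNReal.toReal_mono hCtop hCn
      have hmono : ∫ ω, (1 - ξ ^ 2 / 2 * condVar a σ (fun r => X r ω) n) ∂Q ≤ L ξ n := by
        simp only [hL, NNReal.coe_natCast]
        refine integral_mono ((integrable_const 1).sub (hVi.const_mul _)) ?_ fun ω => ?_
        · refine Integrable.of_bound (C := 1) (hVm.const_mul _).neg.exp.aestronglyMeasurable
            (Eventually.of_forall fun ω => ?_)
          rw [Real.norm_eq_abs, Real.abs_exp, Real.exp_le_one_iff]
          exact neg_nonpos.2 (mul_nonneg (by positivity) (hV0 ω))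
        · have := Real.add_one_le_exp (-(ξ ^ 2 / 2 * condVar a σ (fun r => X r ω) n))
          dsimp only
          linarith
      rw [integral_sub (integrable_const 1) (hVi.const_mul _), integral_const_mul] at hmono
      simp only [integral_const, probReal_univ, smul_eq_mul, mul_one] at hmono
      have : ξ ^ 2 / 2 * ∫ ω, condVar a σ (fun r => X r ω) n ∂Q ≤ ξ ^ 2 / 2 * C.toReal := by
        gcongr
      linarith
    have hlow : ∀ ξ, 1 - ξ ^ 2 / 2 * C.toReal ≤ ⨅ t, L ξ t := fun ξ =>
      ge_of_tendsto' ((hLlim ξ).comp hcast) (hle ξ)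
    have hup : ∀ ξ, ⨅ t, L ξ t ≤ 1 := fun ξ => by
      refine le_of_tendsto' (hLlim ξ) fun t => ?_
      have h1 : L ξ t ≤ ∫ _, (1 : ℝ) ∂Q := by
        refine integral_mono_of_nonneg (Eventually.of_forall fun ω => Real.exp_nonneg _)
          (integrable_const 1) (Eventually.of_forall fun ω => ?_)
        exact Real.exp_le_one_iff.2 (neg_nonpos.2
          (mul_nonneg (by positivity) (condVar_nonneg t)))
      simpa using h1
    have h0 : ⨅ t, L 0 t = 1 := le_antisymm (hup 0) (by simpa using hlow 0)
    refine (Complex.continuous_ofReal.continuousAt (x := ⨅ t, L 0 t)).comp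
      (f := fun ξ => ⨅ t, L ξ t) ?_
    rw [ContinuousAt, h0]
    refine tendsto_of_tendsto_of_tendsto_of_le_of_le (g := fun ξ : ℝ => 1 - ξ ^ 2 / 2 * C.toReal)
      (h := fun _ => 1) ?_ tendsto_const_nhds hlow hup
    have hcont : Continuous fun ξ : ℝ => 1 - ξ ^ 2 / 2 * C.toReal := by fun_prop
    simpa using hcont.tendsto 0
  set lawD : (Y' : ℝ≥0 → Ω × Θ → ℝ) → IsSwitchingDiffusion a σ Q X Q' F W Y' → ℝ≥0 →
      ProbabilityMeasure ℝ := fun Y' hY' t => ⟨(Q.prod Q').map (centered a X Y' t),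
    Measure.isProbabilityMeasure_map (aemeasurable_centered hX.measurable hc hY' t)⟩ with hlawD
  obtain ⟨ν, hν⟩ := exists_charFun_eq_of_tendsto (μ := fun n => lawD Y hY n) hφ fun ξ =>
    (hchar Y hY ξ).comp hcast
  have hconv : ∀ (Y' : ℝ≥0 → Ω × Θ → ℝ) (hY' : IsSwitchingDiffusion a σ Q X Q' F W Y'),
      Tendsto (lawD Y' hY') atTop (𝓝 ν) := fun Y' hY' => by
    refine tendsto_of_seq_tendsto fun u hu => ?_
    refine ProbabilityMeasure.tendsto_of_tendsto_charFun fun ξ => ?_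
    rw [hν ξ]
    exact (hchar Y' hY' ξ).comp hu
  refine ⟨ν, fun Y' hY' => ?_, fun p hp => ?_⟩
  · have hcm := aemeasurable_centered hX.measurable hc hY'
    -- Slutsky: the difference is the propagator times the initial value, which tends to 0 almost
    -- surely.
    refine tendstoInDistribution_of_tendstoInMeasure_sub (X := centered a X Y') Y' _ ?_ ?_
      hY'.aemeasurable
    · refine ⟨hcm, aemeasurable_id, ?_⟩
      have h1 := hconv Y' hY'
      have e : (⟨Measure.map id (ν : Measure ℝ), Measure.isProbabilityMeasure_map aemeasurable_id⟩ :
          ProbabilityMeasure ℝ) = ν := Subtype.ext Measure.map_id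
      rw [e]
      exact h1
    · refine tendstoInMeasure_of_ae_tendsto
        (fun t => (hY'.aemeasurable t).sub (hcm t)) ?_
      have hd := Measure.quasiMeasurePreserving_fst (μ := Q) (ν := Q') |>.ae
        (ae_tendsto_decay (a := a) hlam hq hirr hmu hX hc ha hl)
      filter_upwards [hd] with p hp
      simpa [centered] using hp.mul_const (Y' 0 p)
  · obtain ⟨C, hCtop, hC⟩ := exists_lintegral_condVar_pow_le (a := a) (σ := σ) hlam hq hirr hmu hX
      hc ha hl hp
    refine ne_top_of_le_ne_top (ENNReal.mul_ne_top hCtop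
      (lintegral_abs_pow_gaussianReal_ne_top (2 * p) 1)) ?_
    refine lintegral_le_of_tendsto ((hconv Y hY).comp hcast) (by fun_prop)
      (fun r => by positivity) fun n => ?_
    refine (lintegral_centered_pow hX.measurable hstep hW hY n p).trans_le ?_
    gcongr
    exact hC n

end Solution

end MarkovSwitching

end

theorem theorem1 {N : ℕ} (hN : 1 < N)
    (lam : Fin N → ℝ) (hlam : ∀ i, 0 < lam i)
    (q : Matrix (Fin N) (Fin N) ℝ) (hq : q ∈ Matrix.rowStochastic ℝ (Fin N))
    (hq_diag : ∀ i, q i i = 0) (hq_irr : q.IsIrreducible)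
    (mu : Fin N → ℝ) (hmu : MarkovSwitching.IsInvariantProbability lam q mu)
    (a σ : Fin N → ℝ)
    {Ω : Type*} [MeasurableSpace Ω] (Q : Measure Ω) [IsProbabilityMeasure Q]
    (X : ℝ≥0 → Ω → Fin N) (hX : MarkovSwitching.IsMarkovJumpProcess lam q mu Q X)
    {Θ : Type*} {mΘ : MeasurableSpace Θ} (Q' : Measure Θ) [IsProbabilityMeasure Q']
    (F : Filtration ℝ≥0 mΘ) (W : ℝ≥0 → Θ → ℝ)
    (hW : MarkovSwitching.IsFiltrationBrownian Q' F W)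
    (Y : ℝ≥0 → Ω × Θ → ℝ) (hY : MarkovSwitching.IsSwitchingDiffusion a σ Q X Q' F W Y)
    (ha_mean : ∑ i, a i * mu i < 0) (ha : ∀ i, a i ≤ 0) :
    (∃! ν : ProbabilityMeasure ℝ, MarkovSwitching.IsLimitLaw a σ Q X Q' F W ν) ∧
      ∀ ν : ProbabilityMeasure ℝ, MarkovSwitching.IsLimitLaw a σ Q X Q' F W ν →
        ∀ s : ℝ, 0 < s → ∫⁻ x, ENNReal.ofReal (|x| ^ s) ∂(ν : Measure ℝ) < ∞ := by
  have hne : Nonempty (Fin N) := ⟨⟨0, by omega⟩⟩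
  -- The negative mean enters only through the existence of such a state.
  obtain ⟨l, hl⟩ : ∃ l, a l < 0 := by
    by_contra! h
    refine absurd ha_mean (not_lt.2 (Finset.sum_nonneg fun i _ => ?_))
    exact mul_nonneg (h i) (hmu.mem_stdSimplex.1 i)
  obtain ⟨X', hX', hstep, hae⟩ := MarkovSwitching.exists_step_modification hX
  obtain ⟨ν, hν, hmom⟩ := MarkovSwitching.exists_isLimitLaw_of_step hlam hq hq_irr hmu hX' hstep
    hW (hY.congr_path hae) ha hl
  have hlim : MarkovSwitching.IsLimitLaw a σ Q X Q' F W ν := fun Y' hY' =>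
    hν Y' (hY'.congr_path hae)
  -- The given solution `Y` matters here: without any solution every measure would vacuously be a
  -- limit law.
  have huniq : ∀ ν' : ProbabilityMeasure ℝ, MarkovSwitching.IsLimitLaw a σ Q X Q' F W ν' →
      ν' = ν := fun ν' hν' => by
    have h := tendstoInDistribution_unique Y (hν' Y hY) (hlim Y hY)
    rw [Measure.map_id, Measure.map_id] at h
    exact Subtype.ext h
  refine ⟨⟨ν, hlim, huniq⟩, fun ν' hν' s hs => ?_⟩
  rw [huniq ν' hν']
  -- The real moment of order `s` is dominated by 1 plus the even moment of order `2 * p`.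
  obtain ⟨p, hp⟩ := exists_nat_ge s
  have hp0 : p ≠ 0 := by
    rintro rfl
    simp at hp
    linarith
  have hle : ∀ x : ℝ, ENNReal.ofReal (|x| ^ s) ≤ 1 + ENNReal.ofReal (|x| ^ (2 * p)) := fun x => by
    rw [← ENNReal.ofReal_one, ← ENNReal.ofReal_add zero_le_one (by positivity)]
    refine ENNReal.ofReal_le_ofReal ?_
    rcases le_total |x| 1 with h | h
    · have h1 : |x| ^ s ≤ 1 := Real.rpow_le_one (abs_nonneg x) h hs.le
      have h2 : 0 ≤ |x| ^ (2 * p) := by positivity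
      linarith
    · have h1 : |x| ^ s ≤ |x| ^ ((2 * p : ℕ) : ℝ) :=
        Real.rpow_le_rpow_of_exponent_le h (by push_cast; linarith)
      rw [Real.rpow_natCast] at h1
      linarith
  refine (lintegral_mono hle).trans_lt ?_
  rw [lintegral_add_left measurable_const]
  simpa using lt_top_iff_ne_top.2 (hmom p hp0)
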